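/- Let $F$ be a $p$-adic field (a finite extension of $\mathbb Q_p$), let $L=\widehat{F^{\rm un}}$ be the completion of its maximal unramified extension, and let $I={\rm Gal}(\bar L/L)$ be the inertia group. Let $F_r\subset L$ be the unramified extension of $F$ of degree $r\ge 1$, and let $\theta$ be a generator of ${\rm Gal}(F_r/F)$. For an $F$-torus $T$ let $\kappa_T:T(L)\to X_*(T)_I$ be the Kottwitz homomorphism: if $E/L$ is a finite Galois extension that splits $T$, with normalized valuation ${\rm ord}_E:E^\times\to\mathbb Z$, then the norm $N_{E/L}:T(E)\to T(L)$ is surjective, and $\kappa_T(N_{E/L}(t'))$ is, for each $t'\in T(E)$, the class in $X_*(T)_I=X_*(T)_{{\rm Gal}(E/L)}$ of the cocharacter $\chi\mapsto {\rm ord}_E(\chi(t'))$ in ${\rm Hom}(X^*(T),\mathbb Z)=X_*(T)$. Put $T(F)_1=T(F)\cap\ker\kappa_T$ and $T(F_r)_1=T(F_r)\cap\ker\kappa_T$. Then, for every $F$-torus $T$, the norm $N_r(t)=t\,\theta(t)\cdots\theta^{r-1}(t)$ defines a surjective homomorphism $$N_r:T(F_r)_1\longrightarrow T(F)_1.$$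 -/

import Mathlib

open scoped TensorProduct

noncomputable section

namespace PadicTorus

/-! ### Affine commutative group schemes: points, characters, cocharacters -/

section Characters

variable (F : Type*) [Field F] (A : Type*) [CommRing A] [HopfAlgebra F A]

/-- `T` is a split torus over the field extension `E` of `F`: the base change of `T` to `E` is
isomorphic, as a group scheme, to `𝔾ₘⁿ = Spec E[ℤⁿ]` for some `n`. -/
def IsSplitOver (E : Type*) [Field E] [Algebra F E] : Prop :=
  ∃ n : ℕ, Nonempty (E ⊗[F] A ≃ₐc[E] AddMonoidAlgebra E (Fin n → ℤ))

/-- `T = Spec A` is an `F`-torus: it becomes a split torus over an algebraic closure of `F`. -/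
def IsTorus : Prop := IsSplitOver F A (AlgebraicClosure F)

/-- The group `X^*(T)` of characters of `T` defined over `E`, written multiplicatively: a
homomorphism `T_E → 𝔾ₘ` is the same thing as a group-like element of the coordinate ring. -/
abbrev Char (E : Type*) [Field E] [Algebra F E] : Type _ := GroupLike E (E ⊗[F] A)

/-- The cocharacter group `X_*(T) = Hom(X^*(T), ℤ)`, for `E` a splitting field of `T`
(written multiplicatively). -/
abbrev Cochar (E : Type*) [Field E] [Algebra F E] : Type _ := Char F A E →* Multiplicative ℤ

variable {F A}
variable {E : Type*} [Field E] [Algebra F E]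

lemma isGroupLikeElem_map (g : E ≃ₐ[F] E) {x : E ⊗[F] A} (hx : IsGroupLikeElem E x) :
    IsGroupLikeElem E (Algebra.TensorProduct.map g.toAlgHom (AlgHom.id F A) x) := by
  set τ := Algebra.TensorProduct.map g.toAlgHom (AlgHom.id F A) with hτ
  have hsmul : ∀ (e : E) (y : E ⊗[F] A), τ (e • y) = g e • τ y := by
    intro e y
    induction y with
    | zero => simp
    | add y z hy hz => simp only [smul_add, map_add, hy, hz]
    | tmul e' a => simp [hτ, TensorProduct.smul_tmul']
  let τₗ : E ⊗[F] A →ₛₗ[(g : E →+* E)] E ⊗[F] A :=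
    { toFun := τ, map_add' := map_add τ, map_smul' := hsmul }
  have hcounit : ∀ y : E ⊗[F] A,
      Coalgebra.counit (R := E) (τ y) = g (Coalgebra.counit (R := E) y) := by
    intro y
    induction y with
    | zero => simp
    | add y z hy hz => simp only [map_add, hy, hz]
    | tmul e' a => simp [hτ]
  have hcomul : ∀ y : E ⊗[F] A, Coalgebra.comul (R := E) (τ y) =
      TensorProduct.map τₗ τₗ (Coalgebra.comul (R := E) y) := by
    intro y
    induction y with
    | zero => simp
    | add y z hy hz => simp only [map_add, hy, hz]
    | tmul e' a =>
      simp [hτ, τₗ, ← (Coalgebra.Repr.arbitrary F a).eq, TensorProduct.tmul_sum]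
  exact ⟨by rw [hcounit, hx.counit_eq_one, map_one], by
    rw [hcomul, hx.comul_eq_tmul_self, TensorProduct.map_tmul]; rfl⟩

/-- The action of an automorphism `g` of `E` on characters, through the coefficients. -/
def galChar (g : E ≃ₐ[F] E) : Char F A E →* Char F A E where
  toFun χ := ⟨Algebra.TensorProduct.map g.toAlgHom (AlgHom.id F A) χ.val,
    isGroupLikeElem_map g χ.2⟩
  map_one' := by
    apply GroupLike.val_injective
    simp
  map_mul' χ ψ := by
    apply GroupLike.val_injective
    simp

/-- The action of an automorphism on cocharacters: `⟨χ, g x⟩ = ⟨g⁻¹ χ, x⟩`. -/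
def galCochar (g : E ≃ₐ[F] E) (x : Cochar F A E) : Cochar F A E := x.comp (galChar g.symm)

variable (F A E)
variable (L : Type*) [Field L] [Algebra F L] [Algebra L E] [IsScalarTower F L E]

/-- The subgroup of `X_*(T)` generated by the elements `g x - x`, `g ∈ Gal(E/L)`. -/
def augmentation : Subgroup (Cochar F A E) :=
  Subgroup.closure {z | ∃ (g : E ≃ₐ[L] E) (x : Cochar F A E),
    z = galCochar (g.restrictScalars F) x / x}

/-- The coinvariants `X_*(T)_I`: if `E` splits `T`, inertia acts on `X_*(T)` through `Gal(E/L)`. -/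
abbrev Coinvariants : Type _ := Cochar F A E ⧸ augmentation F A E L

end Characters

section Points

variable (F : Type*) [Field F] (A : Type*) [CommRing A] [HopfAlgebra F A]

/-- The set `T(R)` of `R`-points of `T = Spec A`, with `A` a commutative Hopf algebra over `F`. Its
group law is the convolution product. -/
def Points (R : Type*) [CommRing R] [Algebra F R] : Type _ := WithConv (A →ₐ[F] R)

variable {F A}

/-- The commutative group structure on `T(R)`; the inverse is composition with the antipode. -/
instance [Coalgebra.IsCocomm F A] (R : Type*) [CommRing R] [Algebra F R] :
    CommGroup (Points F A R) :=
  { (inferInstance : CommMonoid (WithConv (A →ₐ[F] R))) with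
    inv := fun f => WithConv.toConv (f.ofConv.comp (HopfAlgebra.antipodeAlgHom F A))
    inv_mul_cancel := by
      intro f
      apply WithConv.ofConv_injective
      apply AlgHom.ext
      intro a
      have h := congrArg f.ofConv (HopfAlgebra.mul_antipode_rTensor_comul_apply (R := F) a)
      refine (AlgHom.convMul_apply _ _ _).trans ?_
      refine Eq.trans ?_ (AlgHom.convOne_apply (A := R) a).symm
      rw [AlgHom.commutes] at h
      rw [← h]
      generalize Coalgebra.comul (R := F) a = z
      induction z with
      | zero => simp
      | add x y hx hy => simp only [map_add, hx, hy]
      | tmul x y => simp }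

variable [Coalgebra.IsCocomm F A]

/-- The homomorphism `T(R) → T(S)` induced by an `F`-algebra homomorphism `R → S`. -/
def Points.map {R S : Type*} [CommRing R] [Algebra F R] [CommRing S] [Algebra F S]
    (f : R →ₐ[F] S) : Points F A R →* Points F A S where
  toFun t := WithConv.toConv (f.comp t.ofConv)
  map_one' := by
    apply WithConv.ofConv_injective
    apply AlgHom.ext
    intro a
    exact f.commutes _
  map_mul' x y := WithConv.ofConv_injective (AlgHom.comp_convMul_distrib f x y)

variable {E : Type*} [Field E] [Algebra F E]

/-- The `E`-algebra homomorphism `E ⊗ A → E` given by a point `t ∈ T(E)`. -/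
def evalAlgHom (t : Points F A E) : E ⊗[F] A →ₐ[E] E :=
  Algebra.TensorProduct.lift (AlgHom.id E E) t.ofConv (fun _ _ => Commute.all _ _)

lemma evalAlgHom_one (x : E ⊗[F] A) :
    evalAlgHom (1 : Points F A E) x = Coalgebra.counit (R := E) x := by
  have : evalAlgHom (1 : Points F A E) = Bialgebra.counitAlgHom E (E ⊗[F] A) := by
    ext a
    refine Eq.trans (b := algebraMap F E (Coalgebra.counit a)) ?_ ?_
    · simp only [evalAlgHom, AlgHom.comp_apply, AlgHom.restrictScalars_apply,
        Algebra.TensorProduct.includeRight_apply, Algebra.TensorProduct.lift_tmul, map_one, one_mul]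
      exact AlgHom.convOne_apply (A := E) a
    · simp [Algebra.algebraMap_eq_smul_one]
  exact DFunLike.congr_fun this x

lemma evalAlgHom_mul (s t : Points F A E) (x : E ⊗[F] A) :
    evalAlgHom (s * t) x = Algebra.TensorProduct.lift (evalAlgHom s) (evalAlgHom t)
      (fun _ _ => Commute.all _ _) (Coalgebra.comul (R := E) x) := by
  have : evalAlgHom (s * t) = (Algebra.TensorProduct.lift (evalAlgHom s) (evalAlgHom t)
      (fun _ _ => Commute.all _ _)).comp (Bialgebra.comulAlgHom E (E ⊗[F] A)) := by
    ext a
    refine Eq.trans (b := Algebra.TensorProduct.lift s.ofConv t.ofConv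
      (fun _ _ => Commute.all _ _) (Coalgebra.comul (R := F) a)) ?_ ?_
    · simp only [evalAlgHom, AlgHom.comp_apply, AlgHom.restrictScalars_apply,
        Algebra.TensorProduct.includeRight_apply, Algebra.TensorProduct.lift_tmul, map_one, one_mul]
      exact AlgHom.convMul_apply _ _ a
    · simp [← (Coalgebra.Repr.arbitrary F a).eq, TensorProduct.tmul_sum, evalAlgHom]
  exact DFunLike.congr_fun this x

/-- The value `χ(t) ∈ Eˣ` of a character at a point `t ∈ T(E)`, as a homomorphism in `t`. -/
def evalChar : Points F A E →* (Char F A E →* Eˣ) where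
  toFun t := (Units.map (evalAlgHom t).toMonoidHom).comp (GroupLike.toUnits E)
  map_one' := by
    ext χ
    exact (evalAlgHom_one χ.val).trans χ.2.counit_eq_one
  map_mul' s t := by
    ext χ
    refine (evalAlgHom_mul s t χ.val).trans ?_
    rw [χ.2.comul_eq_tmul_self, Algebra.TensorProduct.lift_tmul]
    rfl

variable (L : Type*) [Field L] [Algebra F L] [Algebra L E] [IsScalarTower F L E]

/-- The homomorphism `T(E) → X_*(T)`, `t ↦ (χ ↦ ord (χ t))`. -/
def ordPoint (ord : Eˣ →* Multiplicative ℤ) : Points F A E →* Cochar F A E where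
  toFun t := ord.comp (evalChar t)
  map_one' := by ext; simp
  map_mul' s t := by ext; simp

variable (F A E) in
/-- The norm `N_{E/L}` on `T(E)`, with values in `T(L) ⊆ T(E)`. -/
def normPoint [FiniteDimensional L E] : Points F A E →* Points F A E :=
  ∏ g : E ≃ₐ[L] E, Points.map (g.restrictScalars F).toAlgHom

/-- The graph of the Kottwitz homomorphism `κ_T : T(L) → X_*(T)_I`, in terms of a finite Galois
extension `E/L` that splits `T` and the normalized valuation `ord` of `E`. Put
`R = Res_{E/L} T_E`, an induced torus with `R(L) = T(E)`, `X_*(R)_I = X_*(T)` and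
`κ_R = ordPoint ord`; the norm `R → T` is surjective on `L`-points, and `κ_T` is the homomorphism
obtained from `κ_R` by passing to the quotient. So `κ_T (N_{E/L} t')` is the class of
`ordPoint ord t'` for every `t' ∈ T(E)`. -/
def kottwitzGraph [FiniteDimensional L E] (ord : Eˣ →* Multiplicative ℤ) :
    Subgroup (Points F A L × Coinvariants F A E L) :=
  ((normPoint F A E L).prod ((QuotientGroup.mk' (augmentation F A E L)).comp
      (ordPoint ord))).range.comap
    ((Points.map (IsScalarTower.toAlgHom F L E)).prodMap (MonoidHom.id _))

end Points

/-! ### The completed maximal unramified extension -/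

section Unramified

variable {p : ℕ} [Fact p.Prime] {F : Type*} [Field F] [Algebra F ℂ_[p]]

/-- A finite extension `K/F` inside `ℂ_p` is unramified if its ramification index is one, that is,
if it has the same value group as `F` (residue fields are finite, hence perfect). -/
def IsUnramified (K : IntermediateField F ℂ_[p]) : Prop :=
  ∀ x ∈ K, ∃ y : F, ‖x‖ = ‖algebraMap F ℂ_[p] y‖

variable (p F)

/-- The maximal unramified extension `F^un` of `F`. -/
def maxUnramified : IntermediateField F ℂ_[p] :=
  ⨆ (K : IntermediateField F ℂ_[p]) (_ : FiniteDimensional F K ∧ IsUnramified K), K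

/-- The completion `L` of `F^un`, as the closure of `F^un` in the complete field `ℂ_p`. -/
def completedUnramified : IntermediateField F ℂ_[p] :=
  { (maxUnramified p F).toSubfield.topologicalClosure with
    algebraMap_mem' := fun x => Subfield.le_topologicalClosure _
      ((maxUnramified p F).algebraMap_mem x) }

variable {p F}

lemma le_completedUnramified (K : IntermediateField F ℂ_[p]) [hK : FiniteDimensional F K]
    (h : IsUnramified K) : K ≤ completedUnramified p F := fun _ hx =>
  Subfield.le_topologicalClosure _
    ((le_iSup₂_of_le (f := fun (K : IntermediateField F ℂ_[p])
      (_ : FiniteDimensional F K ∧ IsUnramified K) => K) K ⟨hK, h⟩ le_rfl) hx)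

/-- The compositum `K L` inside `ℂ_p`, as an extension of `L`. -/
abbrev compositum (K : IntermediateField F ℂ_[p]) :
    IntermediateField (completedUnramified p F) ℂ_[p] :=
  IntermediateField.adjoin (completedUnramified p F) (K : Set ℂ_[p])

instance (K : IntermediateField F ℂ_[p]) [FiniteDimensional F K] :
    FiniteDimensional (completedUnramified p F) (compositum K) := by
  let L := completedUnramified p F
  let b := Module.finBasis F K
  let S : Set ℂ_[p] := Set.range fun i => (b i : ℂ_[p])
  have hS : compositum K = IntermediateField.adjoin L S := by
    apply le_antisymm
    · rw [IntermediateField.adjoin_le_iff]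
      intro x hx
      have h := congrArg (Subtype.val : K → ℂ_[p]) (b.sum_repr ⟨x, hx⟩)
      rw [← show _ = x from h, AddSubmonoidClass.coe_finsetSum]
      refine sum_mem fun i _ => ?_
      have hb : (b i : ℂ_[p]) ∈ IntermediateField.adjoin L S :=
        IntermediateField.subset_adjoin _ _ ⟨i, rfl⟩
      have := (IntermediateField.adjoin L S).smul_mem hb
        (x := algebraMap F L (b.repr ⟨x, hx⟩ i))
      rwa [algebraMap_smul] at this
    · rw [IntermediateField.adjoin_le_iff]
      rintro _ ⟨i, rfl⟩
      exact IntermediateField.subset_adjoin _ _ (b i).2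
  rw [hS]
  refine IntermediateField.finiteDimensional_adjoin (S := S) ?_
  rintro _ ⟨i, rfl⟩
  have h : IsIntegral F (b i : ℂ_[p]) :=
    (IsIntegral.of_finite F (b i)).map (IsScalarTower.toAlgHom F K ℂ_[p])
  exact h.tower_top

/-- `ord` is the normalized valuation of `E`: the surjective homomorphism `Eˣ → ℤ` whose kernel and
sign are those of the `p`-adic absolute value. -/
structure IsNormalizedOrd {L : Type*} [Field L] [Algebra L ℂ_[p]]
    (E : IntermediateField L ℂ_[p]) (ord : Eˣ →* Multiplicative ℤ) : Prop where
  surjective : Function.Surjective ord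
  nonneg_iff : ∀ x : Eˣ, 0 ≤ (ord x).toAdd ↔ ‖((x : E) : ℂ_[p])‖ ≤ 1

end Unramified

/-! ### The kernel of the Kottwitz homomorphism -/

section Kottwitz

variable (p : ℕ) [Fact p.Prime] (F : Type*) [Field F] [Algebra F ℂ_[p]]
  (A : Type*) [CommRing A] [HopfAlgebra F A]

/-- A finite Galois extension `K/F` that splits `T`, with the normalized valuation of `E = K L`. -/
structure SplittingDatum where
  /-- the splitting field -/
  K : IntermediateField F ℂ_[p]
  finite : FiniteDimensional F K
  galois : IsGalois F K
  split : IsSplitOver F A K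
  /-- the normalized valuation of `K L` -/
  ord : (compositum K)ˣ →* Multiplicative ℤ
  isNormalizedOrd : IsNormalizedOrd (compositum K) ord

variable [Coalgebra.IsCocomm F A]

/-- The kernel of `κ_T`, computed with a given splitting field. -/
def SplittingDatum.kottwitzKer (D : SplittingDatum p F A) :
    Subgroup (Points F A (completedUnramified p F)) :=
  haveI := D.finite
  (kottwitzGraph (completedUnramified p F) D.ord).comap (MonoidHom.inl _ _)

/-- `T(L)_1 = ker κ_T`. Since `κ_T` does not depend on the splitting field, the subgroups in the
supremum all coincide; the supremum only avoids a choice. -/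
def kottwitzKer : Subgroup (Points F A (completedUnramified p F)) :=
  ⨆ D : SplittingDatum p F A, D.kottwitzKer

variable {p F}

/-- `T(R)_1 = T(R) ∩ ker κ_T`, for a subextension `R` of `L/F` given by its embedding in `L`. -/
def pointsOne {R : Type*} [CommRing R] [Algebra F R] (i : R →ₐ[F] completedUnramified p F) :
    Subgroup (Points F A R) :=
  (kottwitzKer p F A).comap (Points.map i)

end Kottwitz

end PadicTorus

end

noncomputable section

namespace PadicTorus

/-!
Extend the Frobenius of `F` to an isometry `σ` of `ℂ_p`, so that the fixed points of `σ^r` in `L`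
form the unramified extension `F_r`. Let `E = K L` split `T`. Every element of `T(L)_1` is the norm
of a point of `T(E)` all of whose character values are units: the classes `g x - x` killed in
`X_*(T)_I` come from points `g u / u` of norm one. For an isometry `τ` inducing a power of
Frobenius, some power `τ^m` fixes `K`, hence acts trivially on characters, and `s ↦ τ^m s / s` is
surjective on the integral points of `T(E)` because it is so on the units of `E`, by successive
approximation. Telescoping and taking norms, `z ↦ τ z / z` is surjective on `T(L)_1`.

Given `y ∈ T(F)_1`, write `y = σ^r z / z` with `z ∈ T(L)_1` and put `u = σ z / z`. Since `σ y = y`,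
the point `u` is fixed by `σ^r`, so `u ∈ T(F_r)_1`. The product of the `θ^i u` runs over the whole
Galois group, like that of the `σ^i u`, and the latter telescopes to `σ^r z / z = y`.
-/

/-! ### Residues and roots of unity of order prime to the residue characteristic -/

section Ultrametric

variable {K : Type*} [NormedField K]

lemma exists_root_norm_sub_lt_one [IsAlgClosed K] {P : Polynomial K} (hP : P.Monic) {x : K}
    (hx : ‖P.eval x‖ < 1) : ∃ ζ ∈ P.roots, ‖x - ζ‖ < 1 := by
  by_contra! hfar
  have hprod : (P.roots.map fun ζ => ‖x - ζ‖).prod = ‖P.eval x‖ := by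
    rw [(IsAlgClosed.splits P).eval_eq_prod_roots_of_monic hP, ← normHom_apply,
      map_multiset_prod, Multiset.map_map]
    rfl
  exact (hprod ▸ hx).not_ge (Multiset.one_le_prod fun c hc => by
    obtain ⟨ζ, hζ, rfl⟩ := Multiset.mem_map.1 hc
    exact hfar ζ hζ)

/-- A root of unity of order prime to the residue characteristic, that is, of some order that is a
unit of the ring of integers. -/
def IsTameRoot (ζ : K) : Prop := ∃ N : ℕ, ‖(N : K)‖ = 1 ∧ ζ ^ N = 1

lemma ne_zero_of_norm_natCast_eq_one {N : ℕ} (hN : ‖(N : K)‖ = 1) : N ≠ 0 := by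
  rintro rfl
  simp at hN

namespace IsTameRoot

variable {ζ ξ : K}

lemma isOfFinOrder (h : IsTameRoot ζ) : IsOfFinOrder ζ := by
  obtain ⟨N, hN, hζ⟩ := h
  exact isOfFinOrder_iff_pow_eq_one.2 ⟨N, (ne_zero_of_norm_natCast_eq_one hN).bot_lt, hζ⟩

lemma norm_eq_one (h : IsTameRoot ζ) : ‖ζ‖ = 1 := h.isOfFinOrder.norm_eq_one

lemma ne_zero (h : IsTameRoot ζ) : ζ ≠ 0 :=
  norm_ne_zero_iff.1 (by rw [h.norm_eq_one]; exact one_ne_zero)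

lemma pow (h : IsTameRoot ζ) (n : ℕ) : IsTameRoot (ζ ^ n) := by
  obtain ⟨N, hN, h⟩ := h
  exact ⟨N, hN, by rw [← pow_mul, mul_comm, pow_mul, h, one_pow]⟩

lemma map {G : Type*} [FunLike G K K] [MonoidHomClass G K K] (h : IsTameRoot ζ) (τ : G) :
    IsTameRoot (τ ζ) := by
  obtain ⟨N, hN, h⟩ := h
  exact ⟨N, hN, by rw [← map_pow, h, map_one]⟩

lemma div (hζ : IsTameRoot ζ) (hξ : IsTameRoot ξ) : IsTameRoot (ζ / ξ) := by
  obtain ⟨N, hN, hζN⟩ := hζ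
  obtain ⟨M, hM, hξM⟩ := hξ
  exact ⟨N * M, by rw [Nat.cast_mul, norm_mul, hN, hM, one_mul], by
    rw [div_pow, pow_mul, hζN, one_pow, mul_comm, pow_mul, hξM, one_pow, div_one]⟩

end IsTameRoot

variable [IsUltrametricDist K]

lemma norm_sub_lt_trans {x y z : K} {c : ℝ} (h : ‖x - y‖ < c) (h' : ‖y - z‖ < c) :
    ‖x - z‖ < c := by
  simpa only [dist_eq_norm] using
    (dist_triangle_max x y z).trans_lt (max_lt (by rwa [dist_eq_norm]) (by rwa [dist_eq_norm]))

lemma norm_sub_le_one {x y : K} (hx : ‖x‖ ≤ 1) (hy : ‖y‖ ≤ 1) : ‖x - y‖ ≤ 1 := by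
  simpa only [sub_eq_add_neg, norm_neg] using
    (IsUltrametricDist.norm_add_le_max x (-y)).trans (max_le hx (by rwa [norm_neg]))

lemma norm_le_one_of_norm_sub_lt_one {x y : K} (hx : ‖x‖ ≤ 1) (h : ‖x - y‖ < 1) : ‖y‖ ≤ 1 := by
  simpa only [sub_sub_cancel] using norm_sub_le_one hx h.le

lemma norm_eq_of_norm_sub_lt {x y : K} (h : ‖x - y‖ < ‖x‖) : ‖y‖ = ‖x‖ := by
  rw [sub_eq_add_neg] at h
  rw [IsUltrametricDist.norm_eq_of_add_norm_lt_max (h.trans_le (le_max_left _ _)), norm_neg]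

variable (K) in
/-- The ring of integers of an ultrametric field. -/
abbrev Integers : ValuationSubring K := (NormedField.valuation (K := K)).valuationSubring

lemma mem_integers {x : K} : x ∈ Integers K ↔ ‖x‖ ≤ 1 := by
  rw [Valuation.mem_valuationSubring_iff, NormedField.valuation_apply]
  exact Iff.rfl

variable (K) in
/-- The residue field of an ultrametric field. -/
abbrev Residue : Type _ := IsLocalRing.ResidueField (Integers K)

lemma residue_eq_zero {a : Integers K} :
    IsLocalRing.residue (Integers K) a = 0 ↔ ‖(a : K)‖ < 1 := by
  rw [IsLocalRing.residue_eq_zero_iff, ValuationSubring.valuation_lt_one_iff,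
    ← (Valuation.isEquiv_valuation_valuationSubring _).lt_one_iff_lt_one,
    NormedField.valuation_apply]
  exact Iff.rfl

lemma residue_eq {a b : Integers K} :
    IsLocalRing.residue (Integers K) a = IsLocalRing.residue (Integers K) b ↔
      ‖(a : K) - b‖ < 1 := by
  rw [← sub_eq_zero, ← map_sub, residue_eq_zero]
  rfl

lemma norm_pow_sub_pow_lt_one {x y : K} (hx : ‖x‖ ≤ 1) (h : ‖x - y‖ < 1) (n : ℕ) :
    ‖x ^ n - y ^ n‖ < 1 := by
  have hy := norm_le_one_of_norm_sub_lt_one hx h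
  have hxy : IsLocalRing.residue (Integers K) ⟨x, mem_integers.2 hx⟩ =
    IsLocalRing.residue (Integers K) ⟨y, mem_integers.2 hy⟩ := residue_eq.2 h
  have := congrArg (· ^ n) hxy
  simp only [← map_pow] at this
  exact residue_eq.1 this

lemma eq_one_of_pow_eq_one {x : K} {n : ℕ} (hn : ‖(n : K)‖ = 1) (hx : x ^ n = 1)
    (h : ‖x - 1‖ < 1) : x = 1 := by
  by_contra hne
  have hx1 : ‖x‖ ≤ 1 :=
    norm_le_one_of_norm_sub_lt_one norm_one.le (by rwa [norm_sub_rev])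
  have hgeom : ∑ i ∈ Finset.range n, x ^ i = 0 := by
    have := mul_geom_sum x n
    rw [hx, sub_self] at this
    exact (mul_eq_zero.1 this).resolve_left (sub_ne_zero.2 hne)
  have hsum : -(n : K) = ∑ i ∈ Finset.range n, (x ^ i - 1) := by simp [hgeom]
  obtain ⟨i, -, hi⟩ :=
    IsUltrametricDist.exists_norm_finsetSum_le (Finset.range n) fun i => x ^ i - 1
  have hlt := hi.trans_lt (by simpa only [one_pow] using norm_pow_sub_pow_lt_one hx1 h i)
  rw [← hsum, norm_neg, hn] at hlt
  exact lt_irrefl _ hlt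

lemma IsTameRoot.eq_of_norm_sub_lt_one {ζ ξ : K} (hζ : IsTameRoot ζ) (hξ : IsTameRoot ξ)
    (h : ‖ζ - ξ‖ < 1) : ζ = ξ := by
  obtain ⟨N, hN, hpow⟩ := hζ.div hξ
  refine (div_eq_one_iff_eq hξ.ne_zero).1 (eq_one_of_pow_eq_one hN hpow ?_)
  rwa [div_sub_one hξ.ne_zero, norm_div, hξ.norm_eq_one, div_one]

lemma norm_natCast_sub_one_eq_one {q : ℕ} (hq₀ : 0 < q) (hq : ‖(q : K)‖ < 1) :
    ‖((q - 1 : ℕ) : K)‖ = 1 := by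
  rw [Nat.cast_pred hq₀, norm_sub_rev, norm_eq_of_norm_sub_lt (x := 1) (by simpa), norm_one]

section PrimePower

variable {p : ℕ} [Fact p.Prime]

lemma coprime_of_norm_natCast_eq_one (hp : ‖(p : K)‖ < 1) {N : ℕ} (hN : ‖(N : K)‖ = 1) :
    p.Coprime N := by
  refine ((Fact.out : p.Prime).coprime_iff_not_dvd).2 ?_
  rintro ⟨M, rfl⟩
  rw [Nat.cast_mul, norm_mul] at hN
  exact (mul_lt_one_of_nonneg_of_lt_one_left (norm_nonneg _) hp
    (IsUltrametricDist.norm_natCast_le_one K M)).ne hN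

lemma norm_pow_prime_sub_le {x y : K} (hx : ‖x‖ ≤ 1) (hy : ‖y‖ ≤ 1) {c : ℝ}
    (hp : ‖(p : K)‖ ≤ c) (hc : ‖x - y‖ ≤ c) : ‖x ^ p - y ^ p‖ ≤ c * ‖x - y‖ := by
  set δ := x - y with hδ
  have hδ1 : ‖δ‖ ≤ 1 := norm_sub_le_one hx hy
  set S := ∑ k ∈ Finset.Ioo 0 p, y ^ (k - 1) * δ ^ (p - k - 1) * ((p.choose k / p : ℕ) : K)
  have hS : ‖S‖ ≤ 1 := by
    refine IsUltrametricDist.norm_sum_le_of_forall_le_of_nonneg zero_le_one fun k _ => ?_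
    rw [norm_mul, norm_mul, norm_pow, norm_pow]
    exact mul_le_one₀ (mul_le_one₀ (pow_le_one₀ (norm_nonneg _) hy) (by positivity)
      (pow_le_one₀ (norm_nonneg _) hδ1)) (norm_nonneg _)
      (IsUltrametricDist.norm_natCast_le_one _ _)
  have hexpand : x ^ p - y ^ p = (δ ^ (p - 1) + p * y * S) * δ := by
    have hpow : δ ^ p = δ ^ (p - 1) * δ := (pow_sub_one_mul (Fact.out : p.Prime).ne_zero δ).symm
    rw [show x = y + δ by rw [hδ]; ring, add_pow_prime_eq (Fact.out : p.Prime) y δ, hpow]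
    ring
  rw [hexpand, norm_mul]
  gcongr
  refine (IsUltrametricDist.norm_add_le_max _ _).trans (max_le ?_ ?_)
  · rw [norm_pow]
    exact (pow_le_of_le_one (norm_nonneg _) hδ1 (Nat.sub_ne_zero_of_lt
      (Fact.out : p.Prime).one_lt)).trans hc
  · rw [norm_mul, norm_mul, mul_assoc]
    exact (mul_le_of_le_one_right (norm_nonneg _)
      (mul_le_one₀ hy (norm_nonneg _) hS)).trans hp

lemma tendsto_pow_prime_pow_sub (hp : ‖(p : K)‖ < 1) {x y : K} (hx : ‖x‖ ≤ 1) (h : ‖x - y‖ < 1) :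
    Filter.Tendsto (fun k : ℕ => x ^ p ^ k - y ^ p ^ k) Filter.atTop (nhds 0) := by
  have hpow : ∀ {z : K} (n : ℕ), ‖z‖ ≤ 1 → ‖z ^ n‖ ≤ 1 := fun n hz => by
    rw [norm_pow]
    exact pow_le_one₀ (norm_nonneg _) hz
  have hy := norm_le_one_of_norm_sub_lt_one hx h
  set c := max ‖(p : K)‖ ‖x - y‖
  have hc1 : c < 1 := max_lt hp h
  have hc0 : 0 ≤ c := (norm_nonneg _).trans (le_max_left _ _)
  have hbound : ∀ k : ℕ, ‖x ^ p ^ k - y ^ p ^ k‖ ≤ c ^ k * ‖x - y‖ := by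
    intro k
    induction k with
    | zero => simp
    | succ k ih =>
      have hle : ‖x ^ p ^ k - y ^ p ^ k‖ ≤ c := ih.trans <|
        (mul_le_of_le_one_left (norm_nonneg _) (pow_le_one₀ hc0 hc1.le)).trans (le_max_right _ _)
      rw [pow_succ p, pow_mul, pow_mul, pow_succ' c, mul_assoc]
      exact (norm_pow_prime_sub_le (hpow _ hx) (hpow _ hy) (le_max_left _ _) hle).trans
        (mul_le_mul_of_nonneg_left ih hc0)
  refine squeeze_zero_norm hbound ?_
  simpa using (tendsto_pow_atTop_nhds_zero_of_lt_one hc0 hc1).mul_const ‖x - y‖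

lemma IsTameRoot.mem_of_isClosed (hp : ‖(p : K)‖ < 1) {ζ : K} (hζ : IsTameRoot ζ)
    {M : Subfield K} (hM : IsClosed (M : Set K)) {x : K} (hx : x ∈ M) (h : ‖x - ζ‖ < 1) :
    ζ ∈ M := by
  have hx1 : ‖x‖ ≤ 1 :=
    norm_le_one_of_norm_sub_lt_one hζ.norm_eq_one.le (by rwa [norm_sub_rev])
  obtain ⟨N, hN, hζN⟩ := id hζ
  have hperiod : ∀ k : ℕ, ζ ^ p ^ (N.totient * k) = ζ := by
    intro k
    have hmod : p ^ (N.totient * k) ≡ 1 [MOD N] := by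
      rw [pow_mul]
      simpa using (Nat.ModEq.pow_totient (coprime_of_norm_natCast_eq_one hp hN)).pow k
    rw [← pow_mod_orderOf, hmod.of_dvd (orderOf_dvd_of_pow_eq_one hζN), pow_mod_orderOf, pow_one]
  have htotient : 0 < N.totient :=
    Nat.totient_pos.2 (ne_zero_of_norm_natCast_eq_one hN).bot_lt
  -- `ζ` is the Teichmüller limit of the powers `x ^ p ^ (φ(N) k)`.
  have hlim := ((tendsto_pow_prime_pow_sub hp hx1 h).comp
    (Filter.tendsto_id.const_mul_atTop' htotient)).add_const ζ
  rw [zero_add] at hlim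
  refine hM.mem_of_tendsto hlim (Filter.Eventually.of_forall fun k => ?_)
  simp only [Function.comp_apply, id_eq, hperiod k, sub_add_cancel]
  exact pow_mem hx _

end PrimePower

end Ultrametric

/-! ### Finite extensions of `F` inside `ℂ_p` and their residue fields -/

lemma mem_iff_pow_natCard_eq {κ : Type*} [Field κ] (k : Subfield κ) [Finite k] {a : κ} :
    a ∈ k ↔ a ^ Nat.card k = a := by
  have := Fintype.ofFinite k
  rw [Nat.card_eq_fintype_card]
  refine ⟨fun ha => congrArg Subtype.val (FiniteField.pow_card (⟨a, ha⟩ : k)), fun ha => ?_⟩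
  have hsplits : (Polynomial.X ^ Fintype.card k - Polynomial.X : Polynomial k).Splits := by
    rw [Polynomial.splits_iff_card_roots, FiniteField.roots_X_pow_card_sub_X k,
      FiniteField.X_pow_card_sub_X_natDegree_eq _ Fintype.one_lt_card]
    rfl
  simpa using hsplits.mem_range_of_isRoot
    (FiniteField.X_pow_card_sub_X_ne_zero k (Fintype.one_lt_card (α := k))) (i := k.subtype)
    (x := a) (by simp [Polynomial.IsRoot.def, ha])

section Subfields

variable {p : ℕ} [Fact p.Prime]

lemma norm_prime_lt_one : ‖(p : ℂ_[p])‖ < 1 := by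
  simpa using (PadicComplex.norm_extends' p (p : ℚ_[p])).trans_lt Padic.norm_p_lt_one

instance : CharP (Residue ℂ_[p]) p := by
  refine (CharP.charP_iff_prime_eq_zero Fact.out).2 ?_
  rw [← map_natCast (IsLocalRing.residue (Integers ℂ_[p])), residue_eq_zero]
  simpa using norm_prime_lt_one

lemma exists_coe_of_isIntegral {x : ℂ_[p]} (hx : IsIntegral ℚ_[p] x) :
    ∃ b : PadicAlgCl p, (b : ℂ_[p]) = x := by
  have hne : (minpoly ℚ_[p] x).map (algebraMap ℚ_[p] (PadicAlgCl p)) ≠ 0 :=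
    Polynomial.map_ne_zero (minpoly.ne_zero hx)
  refine (IsAlgClosed.splits _).mem_range_of_isRoot hne (i := algebraMap (PadicAlgCl p) ℂ_[p]) ?_
  rw [Polynomial.IsRoot.def, Polynomial.map_map, ← IsScalarTower.algebraMap_eq,
    Polynomial.eval_map_algebraMap, minpoly.aeval]

lemma norm_eq_of_minpoly_eq {x y : ℂ_[p]} (hx : IsIntegral ℚ_[p] x) (hy : IsIntegral ℚ_[p] y)
    (h : minpoly ℚ_[p] x = minpoly ℚ_[p] y) : ‖x‖ = ‖y‖ := by
  obtain ⟨a, rfl⟩ := exists_coe_of_isIntegral hx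
  obtain ⟨b, rfl⟩ := exists_coe_of_isIntegral hy
  have hinj := (algebraMap (PadicAlgCl p) ℂ_[p]).injective
  rw [PadicComplex.coe_eq, PadicComplex.coe_eq, minpoly.algebraMap_eq hinj,
    minpoly.algebraMap_eq hinj] at h
  rw [PadicComplex.norm_extends, PadicComplex.norm_extends, ← PadicAlgCl.spectralNorm_eq,
    ← PadicAlgCl.spectralNorm_eq, spectralNorm, spectralNorm, h]

/-- The image of a subfield `M` of `ℂ_p` in the residue field of `ℂ_p`, that is, the residue field
of `M`. -/
def residueSubfield (M : Subfield ℂ_[p]) : Subfield (Residue ℂ_[p]) where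
  __ := (M.toSubring.comap (Integers ℂ_[p]).subtype).map (IsLocalRing.residue (Integers ℂ_[p]))
  inv_mem' := by
    rintro _ ⟨x, hx, rfl⟩
    by_cases h0 : IsLocalRing.residue (Integers ℂ_[p]) x = 0
    · exact ⟨0, zero_mem M, by rw [h0, inv_zero, map_zero]⟩
    have hx1 : ‖(x : ℂ_[p])‖ = 1 := by
      rw [residue_eq_zero, not_lt] at h0
      exact le_antisymm (mem_integers.1 x.2) h0
    have hx0 : (x : ℂ_[p]) ≠ 0 := norm_ne_zero_iff.1 (by rw [hx1]; exact one_ne_zero)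
    refine ⟨⟨(x : ℂ_[p])⁻¹, mem_integers.2 (by rw [norm_inv, hx1, inv_one])⟩, M.inv_mem hx, ?_⟩
    refine eq_inv_of_mul_eq_one_left ?_
    rw [← map_mul, ← map_one (IsLocalRing.residue (Integers ℂ_[p]))]
    congr 1
    exact Subtype.ext (inv_mul_cancel₀ hx0)

section Extension

variable {F : Type*} [Field F] [Algebra F ℂ_[p]]

/-- The residue field of a subextension of `ℂ_p/F`. -/
abbrev resField (M : IntermediateField F ℂ_[p]) : Subfield (Residue ℂ_[p]) :=
  residueSubfield M.toSubfield

/-- The cardinality of the residue field of a subextension of `ℂ_p/F`. -/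
def resCard (M : IntermediateField F ℂ_[p]) : ℕ := Nat.card (resField M)

end Extension

section Finite

variable {F : Type*} [Field F] [Algebra ℚ_[p] F] [FiniteDimensional ℚ_[p] F] [Algebra F ℂ_[p]]
  [IsScalarTower ℚ_[p] F ℂ_[p]] (M : IntermediateField F ℂ_[p]) [FiniteDimensional F M]

/-- The `ℚ_p`-subspace of `ℂ_p` underlying a subextension of `ℂ_p/F`. -/
abbrev toQpSubmodule (M : IntermediateField F ℂ_[p]) : Submodule ℚ_[p] ℂ_[p] :=
  (Subalgebra.toSubmodule M.toSubalgebra).restrictScalars ℚ_[p]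

instance finiteDimensional_toQpSubmodule : FiniteDimensional ℚ_[p] (toQpSubmodule M) :=
  FiniteDimensional.trans ℚ_[p] F M

instance properSpace_toQpSubmodule : ProperSpace (toQpSubmodule M) :=
  FiniteDimensional.proper ℚ_[p] _

lemma isClosed_of_finiteDimensional : IsClosed (M : Set ℂ_[p]) :=
  (toQpSubmodule M).closed_of_finiteDimensional

variable {M} in
lemma isIntegral_of_mem {x : ℂ_[p]} (hx : x ∈ M) : IsIntegral ℚ_[p] x := by
  have h : IsIntegral F x :=
    (IsIntegral.of_finite F (⟨x, hx⟩ : M)).map (IsScalarTower.toAlgHom F M ℂ_[p])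
  exact isIntegral_trans (R := ℚ_[p]) x h

lemma norm_algEquiv (g : M ≃ₐ[F] M) (x : M) : ‖((g x : M) : ℂ_[p])‖ = ‖(x : ℂ_[p])‖ := by
  apply norm_eq_of_minpoly_eq (isIntegral_of_mem (g x).2) (isIntegral_of_mem x.2)
  have : IsScalarTower ℚ_[p] M ℂ_[p] :=
    IsScalarTower.of_algebraMap_eq fun a => by
      rw [IsScalarTower.algebraMap_apply ℚ_[p] F M, IsScalarTower.algebraMap_apply ℚ_[p] F ℂ_[p]]
      rfl
  calc minpoly ℚ_[p] ((g x : M) : ℂ_[p]) = minpoly ℚ_[p] (g x) :=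
        minpoly.algebraMap_eq (algebraMap M ℂ_[p]).injective (g x)
    _ = minpoly ℚ_[p] x := minpoly.algEquiv_eq (g.restrictScalars ℚ_[p]) x
    _ = minpoly ℚ_[p] (x : ℂ_[p]) :=
        (minpoly.algebraMap_eq (algebraMap M ℂ_[p]).injective x).symm

lemma exists_forall_norm_sub_le (x : ℂ_[p]) : ∃ y ∈ M, ∀ z ∈ M, ‖x - y‖ ≤ ‖x - z‖ := by
  have hcont : Continuous fun y : toQpSubmodule M => ‖x - (y : ℂ_[p])‖ := by fun_prop
  have hlim : Filter.Tendsto (fun y : toQpSubmodule M => ‖x - (y : ℂ_[p])‖)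
      (Filter.cocompact _) Filter.atTop :=
    Filter.tendsto_atTop_mono (fun y => by
      rw [norm_sub_rev, ← sub_eq_add_neg]
      exact norm_sub_norm_le (y : ℂ_[p]) x)
      (Filter.tendsto_atTop_add_const_right _ (-‖x‖) tendsto_norm_cocompact_atTop)
  obtain ⟨y, hy⟩ := hcont.exists_forall_le hlim
  exact ⟨y, y.2, fun z hz => hy ⟨z, hz⟩⟩

-- If the closest point `y` of `M` were not `x`, approximating the normalized difference by `z ∈ M`
-- would give the closer point `y + c z`.
lemma mem_of_forall_exists_norm_sub_lt_one {x : ℂ_[p]}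
    (hval : ∀ y ∈ M, ∃ c ∈ M, ‖x - y‖ = ‖c‖)
    (happ : ∀ y ∈ M, ∀ c ∈ M, ‖c * (x - y)‖ = 1 → ∃ z ∈ M, ‖c * (x - y) - z‖ < 1) : x ∈ M := by
  obtain ⟨y, hy, hmin⟩ := exists_forall_norm_sub_le M x
  by_contra hxM
  have hxy : ‖x - y‖ ≠ 0 := norm_ne_zero_iff.2 (sub_ne_zero.2 fun h => hxM (h ▸ hy))
  obtain ⟨c, hc, hxc⟩ := hval y hy
  rw [hxc] at hxy
  obtain ⟨z, hz, hlt⟩ := happ y hy c⁻¹ (inv_mem hc) (by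
    rw [norm_mul, norm_inv, hxc, inv_mul_cancel₀ hxy])
  have hcloser : ‖x - (y + c * z)‖ < ‖x - y‖ := calc
    ‖x - (y + c * z)‖ = ‖c‖ * ‖c⁻¹ * (x - y) - z‖ := by
      rw [← norm_mul]
      congr 1
      field_simp [norm_ne_zero_iff.1 hxy]
      ring
    _ < ‖c‖ * 1 := mul_lt_mul_of_pos_left hlt (hxy.symm.lt_of_le (norm_nonneg c))
    _ = ‖x - y‖ := by rw [mul_one, hxc]
  exact hcloser.not_ge (hmin _ (add_mem hy (mul_mem hc hz)))

instance finite_resField : Finite (resField M) := by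
  obtain ⟨t, ht, htf, hcov⟩ := (isCompact_closedBall (0 : toQpSubmodule M) 1).finite_cover_balls
    one_pos
  refine (htf.image (fun y : toQpSubmodule M => if h : ‖(y : ℂ_[p])‖ ≤ 1 then
    IsLocalRing.residue (Integers ℂ_[p]) ⟨y, mem_integers.2 h⟩ else 0)).subset ?_
  rintro _ ⟨x, hx, rfl⟩
  have hxball : (⟨x, hx⟩ : toQpSubmodule M) ∈ Metric.closedBall 0 1 :=
    mem_closedBall_zero_iff.2 (mem_integers.1 x.2)
  obtain ⟨y, hy, hxy⟩ : ∃ y ∈ t, (⟨x, hx⟩ : toQpSubmodule M) ∈ Metric.ball y 1 := by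
    simpa only [Set.mem_iUnion, exists_prop] using hcov hxball
  have hy1 : ‖(y : ℂ_[p])‖ ≤ 1 := mem_closedBall_zero_iff.1 (ht hy)
  refine ⟨y, hy, ?_⟩
  simp only [dif_pos hy1]
  rwa [residue_eq, norm_sub_rev, ← dist_eq_norm, ← Metric.mem_ball]

lemma exists_resCard_eq_pow : ∃ f : ℕ, f ≠ 0 ∧ resCard M = p ^ f := by
  have := Fintype.ofFinite (resField M)
  have : CharP (resField M) p := (resField M).subtype.charP (resField M).subtype.injective p
  obtain ⟨n, -, hn⟩ := FiniteField.card (resField M) p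
  exact ⟨n, n.ne_zero, by rw [resCard, Nat.card_eq_fintype_card, hn]⟩

lemma one_lt_resCard : 1 < resCard M := Finite.one_lt_card

lemma norm_resCard_lt_one : ‖(resCard M : ℂ_[p])‖ < 1 := by
  obtain ⟨f, hf, h⟩ := exists_resCard_eq_pow M
  rw [h, Nat.cast_pow, norm_pow]
  exact pow_lt_one₀ (norm_nonneg _) norm_prime_lt_one hf

lemma norm_natCast_resCard_sub_one : ‖((resCard M - 1 : ℕ) : ℂ_[p])‖ = 1 :=
  norm_natCast_sub_one_eq_one (one_lt_resCard M).le (norm_resCard_lt_one M)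

lemma exists_resCard_eq_resCard_pow {N : IntermediateField F ℂ_[p]} (h : N ≤ M) :
    ∃ s : ℕ, s ≠ 0 ∧ resCard M = resCard N ^ s := by
  have hle : resField N ≤ resField M := by
    rintro _ ⟨x, hx, rfl⟩
    exact ⟨x, h hx, rfl⟩
  let _ : Algebra (resField N) (resField M) := (Subfield.inclusion hle).toAlgebra
  exact ⟨Module.finrank (resField N) (resField M), Module.finrank_pos.ne',
    Module.natCard_eq_pow_finrank⟩

variable {M} in
lemma norm_pow_resCard_sub_lt_one {x : ℂ_[p]} (hx : x ∈ M) (hx1 : ‖x‖ ≤ 1) :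
    ‖x ^ resCard M - x‖ < 1 := by
  have hres := (mem_iff_pow_natCard_eq (resField M)
    (a := IsLocalRing.residue (Integers ℂ_[p]) ⟨x, mem_integers.2 hx1⟩)).1
    ⟨⟨x, mem_integers.2 hx1⟩, hx, rfl⟩
  rw [← map_pow] at hres
  exact residue_eq.1 hres

variable {M} in
lemma IsTameRoot.mem_of_norm_sub_lt_one {ζ : ℂ_[p]} (hζ : IsTameRoot ζ) {x : ℂ_[p]} (hx : x ∈ M)
    (h : ‖x - ζ‖ < 1) : ζ ∈ M :=
  hζ.mem_of_isClosed norm_prime_lt_one (M := M.toSubfield) (isClosed_of_finiteDimensional M) hx h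

lemma IsTameRoot.mem_iff {ζ : ℂ_[p]} (hζ : IsTameRoot ζ) : ζ ∈ M ↔ ζ ^ resCard M = ζ := by
  constructor
  · intro h
    exact (hζ.pow _).eq_of_norm_sub_lt_one hζ (norm_pow_resCard_sub_lt_one h hζ.norm_eq_one.le)
  · intro h
    obtain ⟨x, hx, hxζ⟩ : IsLocalRing.residue (Integers ℂ_[p])
        ⟨ζ, mem_integers.2 hζ.norm_eq_one.le⟩ ∈ resField M := by
      refine (mem_iff_pow_natCard_eq _).2 ?_
      rw [← map_pow]
      exact congrArg _ (Subtype.ext h)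
    exact hζ.mem_of_norm_sub_lt_one hx (residue_eq.1 hxζ)

variable {M} in
lemma exists_isTameRoot_mem {x : ℂ_[p]} (hx : x ∈ M) (hx1 : ‖x‖ = 1) :
    ∃ ζ ∈ M, IsTameRoot ζ ∧ ‖x - ζ‖ < 1 := by
  have hq := norm_natCast_resCard_sub_one M
  have hpow : ‖x ^ (resCard M - 1) - 1‖ < 1 := by
    have := norm_pow_resCard_sub_lt_one hx hx1.le
    rwa [← Nat.sub_add_cancel (one_lt_resCard M).le, pow_succ, ← sub_one_mul, norm_mul, hx1,
      mul_one] at this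
  obtain ⟨ζ, hζ, hxζ⟩ := exists_root_norm_sub_lt_one
    (Polynomial.monic_X_pow_sub_C (1 : ℂ_[p]) (ne_zero_of_norm_natCast_eq_one hq)) (x := x)
    (by simpa using hpow)
  have htame : IsTameRoot ζ := by
    refine ⟨resCard M - 1, hq, ?_⟩
    simpa [sub_eq_zero] using Polynomial.isRoot_of_mem_roots hζ
  exact ⟨ζ, htame.mem_of_norm_sub_lt_one hx hxζ, htame, hxζ⟩

end Finite

lemma exists_isTameRoot {x : ℂ_[p]} (hx : ‖x‖ = 1) : ∃ ζ, IsTameRoot ζ ∧ ‖x - ζ‖ < 1 := by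
  obtain ⟨b, hxb⟩ : ∃ b : PadicAlgCl p, ‖x - (b : ℂ_[p])‖ < 1 := by
    obtain ⟨_, ⟨b, rfl⟩, hb⟩ := Metric.mem_closure_iff.1
      (UniformSpace.Completion.denseRange_coe (α := PadicAlgCl p) x) 1 one_pos
    exact ⟨b, by rwa [dist_eq_norm] at hb⟩
  have hb : ‖(b : ℂ_[p])‖ = 1 := by rw [norm_eq_of_norm_sub_lt (by rwa [hx]), hx]
  have : FiniteDimensional ℚ_[p] (IntermediateField.adjoin ℚ_[p] {(b : ℂ_[p])}) :=
    IntermediateField.adjoin.finiteDimensional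
      ((Algebra.IsIntegral.isIntegral (R := ℚ_[p]) b).algebraMap)
  obtain ⟨ζ, -, hζ, hbζ⟩ :=
    exists_isTameRoot_mem (IntermediateField.mem_adjoin_simple_self ℚ_[p] (b : ℂ_[p])) hb
  exact ⟨ζ, hζ, norm_sub_lt_trans hxb hbζ⟩

end Subfields

/-! ### Unramified extensions generated by roots of unity -/

section TameExtensions

open Polynomial

section Ultrametric

variable {K : Type*} [NormedField K] [IsUltrametricDist K]

lemma norm_coeff_prod_X_sub_C_le_one {s : Multiset K} (hs : ∀ a ∈ s, ‖a‖ ≤ 1) (j : ℕ) :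
    ‖(s.map fun a => X - C a).prod.coeff j‖ ≤ 1 := by
  obtain ⟨Q, hQ⟩ : (s.map fun a => X - C a).prod ∈ lifts (Integers K).subtype := by
    refine multiset_prod_mem _ fun P hP => ?_
    obtain ⟨a, ha, rfl⟩ := Multiset.mem_map.1 hP
    exact ⟨X - C ⟨a, mem_integers.2 (hs a ha)⟩, by simp⟩
  rw [← hQ]
  simpa using mem_integers.1 (Q.coeff j).2

lemma norm_sum_pow_sub_sum_pow_lt_one (p : ℕ) [Fact p.Prime] [CharP (Residue K) p] {ι : Type*}
    {s : Finset ι} {a : ι → K} (ha : ∀ i ∈ s, ‖a i‖ ≤ 1) (f : ℕ) :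
    ‖(∑ i ∈ s, a i) ^ p ^ f - ∑ i ∈ s, a i ^ p ^ f‖ < 1 := by
  let b : s → Integers K := fun i => ⟨a i, mem_integers.2 (ha i i.2)⟩
  have hb : IsLocalRing.residue (Integers K) ((∑ i, b i) ^ p ^ f) =
      IsLocalRing.residue (Integers K) (∑ i, b i ^ p ^ f) := by
    simp only [map_pow, map_sum, sum_pow_char_pow]
  rw [residue_eq] at hb
  simpa [b, Finset.sum_attach s a, Finset.sum_attach s fun i => a i ^ p ^ f] using hb

end Ultrametric

section Trace

variable {F M : Type*} [Field F]

lemma sum_coeff_mul_trace_mul_pow [Field M] [Algebra F M] [FiniteDimensional F M] [IsGalois F M]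
    {P : M[X]} {z : M} (hP : ∀ g : M ≃ₐ[F] M, g ≠ 1 → P.eval (g z) = 0) (x : M) :
    ∑ j ∈ Finset.range (P.natDegree + 1),
      P.coeff j * algebraMap F M (Algebra.trace F M (x * z ^ j)) = x * P.eval z := by
  have heval : ∀ g : M ≃ₐ[F] M, ∑ j ∈ Finset.range (P.natDegree + 1),
      P.coeff j * g (x * z ^ j) = g x * P.eval (g z) := fun g => by
    rw [eval_eq_sum_range, Finset.mul_sum]
    exact Finset.sum_congr rfl fun j _ => by rw [map_mul, map_pow]; ring
  simp_rw [trace_eq_sum_automorphisms, Finset.mul_sum]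
  rw [Finset.sum_comm, Finset.sum_congr rfl fun g _ => heval g,
    Finset.sum_eq_single 1 (fun g _ hg => by rw [hP g hg, mul_zero]) (by simp)]
  rfl

variable [NormedField M] [IsUltrametricDist M] [Algebra F M] [FiniteDimensional F M] [IsGalois F M]

/-- If the conjugates of `z` are pairwise incongruent, then `z` generates the ring of integers, the
trace form of which is therefore nondegenerate on residue fields. -/
lemma exists_norm_trace_mul_pow_eq (hM : ∀ (g : M ≃ₐ[F] M) x, ‖g x‖ = ‖x‖) {z : M} (hz : ‖z‖ ≤ 1)
    (hconj : ∀ g : M ≃ₐ[F] M, g ≠ 1 → ‖z - g z‖ = 1) (x : M) :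
    ∃ j : ℕ, ‖algebraMap F M (Algebra.trace F M (x * z ^ j))‖ = ‖x‖ := by
  classical
  have hle : ∀ j : ℕ, ‖algebraMap F M (Algebra.trace F M (x * z ^ j))‖ ≤ ‖x‖ := fun j => by
    rw [trace_eq_sum_automorphisms]
    refine IsUltrametricDist.norm_sum_le_of_forall_le_of_nonneg (norm_nonneg _) fun g _ => ?_
    rw [hM, norm_mul, norm_pow]
    exact mul_le_of_le_one_right (norm_nonneg _) (pow_le_one₀ (norm_nonneg _) hz)
  let s : Finset (M ≃ₐ[F] M) := Finset.univ.erase 1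
  let P : M[X] := ∏ g ∈ s, (X - C (g z))
  have hcoeff : ∀ j, ‖P.coeff j‖ ≤ 1 := by
    have hs : ∀ a ∈ s.val.map fun g : M ≃ₐ[F] M => g z, ‖a‖ ≤ 1 := by
      simp only [Multiset.mem_map]
      rintro _ ⟨g, -, rfl⟩
      rwa [hM]
    intro j
    have := norm_coeff_prod_X_sub_C_le_one hs j
    rwa [Multiset.map_map] at this
  have hroot : ∀ g : M ≃ₐ[F] M, g ≠ 1 → P.eval (g z) = 0 := fun g hg => by
    rw [eval_prod]
    exact Finset.prod_eq_zero (Finset.mem_erase.2 ⟨hg, Finset.mem_univ _⟩) (by simp)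
  have heval : ‖P.eval z‖ = 1 := by
    rw [eval_prod, norm_prod]
    refine Finset.prod_eq_one fun g hg => ?_
    rw [eval_sub, eval_X, eval_C, hconj g (Finset.ne_of_mem_erase hg)]
  obtain ⟨j, -, hj⟩ := IsUltrametricDist.exists_norm_finsetSum_le
    (Finset.range (P.natDegree + 1))
    fun j => P.coeff j * algebraMap F M (Algebra.trace F M (x * z ^ j))
  rw [sum_coeff_mul_trace_mul_pow hroot, norm_mul, norm_mul, heval, mul_one] at hj
  exact ⟨j, (hle j).antisymm (hj.trans (mul_le_of_le_one_left (norm_nonneg _) (hcoeff j)))⟩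

end Trace

namespace IsTameRoot

variable {p : ℕ} [Fact p.Prime] (F : Type*) [Field F] [Algebra F ℂ_[p]] {ζ : ℂ_[p]}

protected lemma isIntegral (hζ : IsTameRoot ζ) : IsIntegral F ζ :=
  IsIntegral.of_pow hζ.isOfFinOrder.orderOf_pos (by rw [pow_orderOf_eq_one]; exact isIntegral_one)

lemma finiteDimensional (hζ : IsTameRoot ζ) :
    FiniteDimensional F (IntermediateField.adjoin F {ζ}) :=
  IntermediateField.adjoin.finiteDimensional (hζ.isIntegral F)

lemma isGalois (hζ : IsTameRoot ζ) : IsGalois F (IntermediateField.adjoin F {ζ}) := by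
  have : NeZero (orderOf ζ) := ⟨hζ.isOfFinOrder.orderOf_pos.ne'⟩
  have : IsCyclotomicExtension {orderOf ζ} F (IntermediateField.adjoin F {ζ}) := by
    change IsCyclotomicExtension _ F (IntermediateField.adjoin F {ζ}).toSubalgebra
    rw [IntermediateField.adjoin_simple_toSubalgebra_of_isAlgebraic (hζ.isIntegral F).isAlgebraic]
    exact (IsPrimitiveRoot.orderOf ζ).adjoin_isCyclotomicExtension F
  exact IsCyclotomicExtension.isGalois {orderOf ζ} F _

variable [Algebra ℚ_[p] F] [FiniteDimensional ℚ_[p] F] [IsScalarTower ℚ_[p] F ℂ_[p]]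

lemma isUnramified (hζ : IsTameRoot ζ) : IsUnramified (IntermediateField.adjoin F {ζ}) := by
  intro x hx
  have := hζ.finiteDimensional F
  have := hζ.isGalois F
  let M := IntermediateField.adjoin F {ζ}
  let z : M := IntermediateField.AdjoinSimple.gen F ζ
  have htame : ∀ g : M ≃ₐ[F] M, IsTameRoot ((g z : M) : ℂ_[p]) := fun g => by
    obtain ⟨N, hN, h⟩ := hζ
    have hz : z ^ N = 1 := Subtype.ext h
    exact ⟨N, hN, by rw [← SubmonoidClass.coe_pow, ← map_pow, hz, map_one]; rfl⟩
  have hconj : ∀ g : M ≃ₐ[F] M, g ≠ 1 → ‖z - g z‖ = 1 := fun g hg => by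
    refine (norm_sub_le_one hζ.norm_eq_one.le (htame g).norm_eq_one.le).antisymm ?_
    by_contra! hlt
    have hgz : g z = z := (Subtype.ext (hζ.eq_of_norm_sub_lt_one (htame g) hlt)).symm
    have hAlg : g.toAlgHom = (1 : M ≃ₐ[F] M).toAlgHom :=
      (IntermediateField.adjoin.powerBasis (hζ.isIntegral F)).algHom_ext (by simpa using hgz)
    exact hg (AlgEquiv.ext fun y => DFunLike.congr_fun hAlg y)
  obtain ⟨j, hj⟩ := exists_norm_trace_mul_pow_eq (fun g y => norm_algEquiv M g y)
    hζ.norm_eq_one.le hconj ⟨x, hx⟩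
  exact ⟨_, hj.symm⟩

end IsTameRoot

end TameExtensions

/-! ### The Frobenius automorphism -/

section Extension

variable {p : ℕ} [Fact p.Prime] {F : Type*} [Field F] [Algebra ℚ_[p] F]
  [Algebra F (PadicAlgCl p)] [IsScalarTower ℚ_[p] F (PadicAlgCl p)]

lemma isClosed_setOf_apply_eq (x y : PadicAlgCl p) :
    IsClosed {g : PadicAlgCl p ≃ₐ[F] PadicAlgCl p | g x = y} := by
  have : Algebra.IsAlgebraic F (PadicAlgCl p) := Algebra.IsAlgebraic.tower_top (K := ℚ_[p]) F
  rcases Set.eq_empty_or_nonempty {g : PadicAlgCl p ≃ₐ[F] PadicAlgCl p | g x = y} with h | ⟨g₀, h⟩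
  · rw [h]
    exact isClosed_empty
  have hcoset : {g : PadicAlgCl p ≃ₐ[F] PadicAlgCl p | g x = y} = (fun g => g₀⁻¹ * g) ⁻¹'
      (MulAction.stabilizer (PadicAlgCl p ≃ₐ[F] PadicAlgCl p) x : Set _) := by
    ext g
    simp only [Set.mem_ofPred_eq, Set.mem_preimage, SetLike.mem_coe,
      MulAction.mem_stabilizer_iff, mul_smul, inv_smul_eq_iff]
    change g x = y ↔ g x = g₀ x
    rw [show g₀ x = y from h]
  rw [hcoset]
  exact (Subgroup.isClosed_of_isOpen _ (stabilizer_isOpen_of_isIntegral (K := F) x)).preimage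
    (continuous_const_mul _)

lemma isGalois_padicAlgCl : IsGalois F (PadicAlgCl p) := by
  have : Algebra.IsAlgebraic F (PadicAlgCl p) := Algebra.IsAlgebraic.tower_top (K := ℚ_[p]) F
  have : IsAlgClosure F (PadicAlgCl p) := ⟨inferInstance, inferInstance⟩
  have : Normal F (PadicAlgCl p) := IsAlgClosure.normal F _
  have : CharZero F := charZero_of_injective_algebraMap (algebraMap ℚ_[p] F).injective
  exact ⟨⟩

lemma isometry_algEquiv (g : PadicAlgCl p ≃ₐ[F] PadicAlgCl p) : Isometry g := by
  refine AddMonoidHomClass.isometry_of_norm g fun x => ?_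
  rw [← PadicAlgCl.spectralNorm_eq, ← PadicAlgCl.spectralNorm_eq]
  exact (spectralNorm_eq_of_equiv (g.restrictScalars ℚ_[p]) x).symm

lemma exists_isometric_extension [Algebra F ℂ_[p]]
    (hF : ∀ a : F, algebraMap (PadicAlgCl p) ℂ_[p] (algebraMap F (PadicAlgCl p) a) =
      algebraMap F ℂ_[p] a) (g : PadicAlgCl p ≃ₐ[F] PadicAlgCl p) :
    ∃ σ : ℂ_[p] ≃ₐ[F] ℂ_[p], (∀ x, ‖σ x‖ = ‖x‖) ∧
      ∀ b : PadicAlgCl p, σ (b : ℂ_[p]) = ((g b : PadicAlgCl p) : ℂ_[p]) := by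
  have hg := isometry_algEquiv g
  let e := UniformSpace.Completion.mapRingEquiv g.toRingEquiv hg.continuous
    (isometry_algEquiv g.symm).continuous
  have he : ∀ b : PadicAlgCl p, e (b : ℂ_[p]) = ((g b : PadicAlgCl p) : ℂ_[p]) :=
    fun b => UniformSpace.Completion.map_coe hg.uniformContinuous b
  have hcomm : ∀ a : F, e (algebraMap F ℂ_[p] a) = algebraMap F ℂ_[p] a := fun a => by
    rw [← hF, ← PadicComplex.coe_eq, he, AlgEquiv.commutes]
  refine ⟨AlgEquiv.ofRingEquiv (f := e) hcomm, fun x => ?_, he⟩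
  change ‖e x‖ = ‖x‖
  have hcont : Continuous e := UniformSpace.Completion.continuous_map
  refine UniformSpace.Completion.induction_on x
    (isClosed_eq hcont.norm continuous_norm) fun b => ?_
  rw [he, PadicComplex.norm_extends, PadicComplex.norm_extends]
  exact (AddMonoidHomClass.isometry_iff_norm g).1 hg b

end Extension

section Frobenius

variable {p : ℕ} [Fact p.Prime] {F : Type*} [Field F] [Algebra ℚ_[p] F]
  [FiniteDimensional ℚ_[p] F] [Algebra F ℂ_[p]] [IsScalarTower ℚ_[p] F ℂ_[p]]

lemma norm_eval_pow_resCard_sub_lt_one (M : IntermediateField F ℂ_[p]) [FiniteDimensional F M]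
    {P : Polynomial ℂ_[p]} (hPM : ∀ i, P.coeff i ∈ M) (hP : ∀ i, ‖P.coeff i‖ ≤ 1) {x : ℂ_[p]}
    (hx : ‖x‖ ≤ 1) : ‖P.eval (x ^ resCard M) - P.eval x ^ resCard M‖ < 1 := by
  obtain ⟨f, -, hq⟩ := exists_resCard_eq_pow M
  have hpow : ∀ n, ‖x ^ n‖ ≤ 1 := fun n => by
    rw [norm_pow]
    exact pow_le_one₀ (norm_nonneg _) hx
  have hterm : ∀ i, ‖P.coeff i * x ^ i‖ ≤ 1 := fun i => by
    rw [norm_mul]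
    exact mul_le_one₀ (hP i) (norm_nonneg _) (hpow i)
  have hfrob := norm_sum_pow_sub_sum_pow_lt_one p (s := Finset.range (P.natDegree + 1))
    (fun i _ => hterm i) f
  rw [← Polynomial.eval_eq_sum_range, ← hq, norm_sub_rev] at hfrob
  refine norm_sub_lt_trans ?_ hfrob
  rw [Polynomial.eval_eq_sum_range, ← Finset.sum_sub_distrib]
  obtain ⟨i, -, hi⟩ := IsUltrametricDist.exists_norm_finsetSum_le
    (Finset.range (P.natDegree + 1))
    fun i => P.coeff i * (x ^ resCard M) ^ i - (P.coeff i * x ^ i) ^ resCard M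
  refine hi.trans_lt ?_
  rw [mul_pow, ← pow_mul, ← pow_mul, mul_comm i, ← sub_mul, norm_mul, norm_sub_rev]
  exact mul_lt_one_of_nonneg_of_lt_one_left (norm_nonneg _)
    (norm_pow_resCard_sub_lt_one (hPM i) (hP i)) (hpow _)

variable (p F) in
/-- The cardinality of the residue field of `F`. -/
def baseCard : ℕ := resCard (⊥ : IntermediateField F ℂ_[p])

open Polynomial in
lemma IsTameRoot.aeval_minpoly_pow_baseCard {ζ : ℂ_[p]} (hζ : IsTameRoot ζ) :
    aeval (ζ ^ baseCard p F) (minpoly F ζ) = 0 := by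
  set P := (minpoly F ζ).map (algebraMap F ℂ_[p]) with hP
  have hPm : P.Monic := (minpoly.monic (hζ.isIntegral F)).map _
  have hroot : ∀ s ∈ P.roots, aeval s (minpoly F ζ) = 0 := fun s hs => by
    have := isRoot_of_mem_roots hs
    rwa [IsRoot.def, eval_map_algebraMap] at this
  have htame : ∀ s ∈ P.roots, IsTameRoot s := fun s hs => by
    obtain ⟨N, hN, hζN⟩ := hζ
    have hdvd : minpoly F ζ ∣ X ^ N - 1 := minpoly.dvd F ζ (by simp [hζN])
    have hs := aeval_eq_zero_of_dvd_aeval_eq_zero hdvd (hroot s hs)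
    exact ⟨N, hN, by simpa [sub_eq_zero] using hs⟩
  have hcoeff : ∀ i, ‖P.coeff i‖ ≤ 1 := fun i => by
    rw [(IsAlgClosed.splits P).eq_prod_roots_of_monic hPm]
    exact norm_coeff_prod_X_sub_C_le_one (fun s hs => (htame s hs).norm_eq_one.le) i
  have heval := norm_eval_pow_resCard_sub_lt_one (⊥ : IntermediateField F ℂ_[p]) (P := P)
    (fun i => by rw [hP, coeff_map]; exact IntermediateField.algebraMap_mem _ _) hcoeff
    hζ.norm_eq_one.le
  have hq : resCard (⊥ : IntermediateField F ℂ_[p]) ≠ 0 :=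
    (zero_lt_one.trans (one_lt_resCard _)).ne'
  rw [show P.eval ζ = 0 by rw [hP, eval_map_algebraMap, minpoly.aeval], zero_pow hq,
    sub_zero] at heval
  obtain ⟨s, hs, hlt⟩ := exists_root_norm_sub_lt_one hPm heval
  rw [baseCard, (hζ.pow _).eq_of_norm_sub_lt_one (htame s hs) hlt]
  exact hroot s hs

section Galois

variable [Algebra F (PadicAlgCl p)] [IsScalarTower ℚ_[p] F (PadicAlgCl p)]

lemma exists_galois_eq_pow_baseCard_of_pow_eq_one (hF : ∀ a : F,
    algebraMap (PadicAlgCl p) ℂ_[p] (algebraMap F (PadicAlgCl p) a) = algebraMap F ℂ_[p] a)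
    {N : ℕ} (hN : ‖(N : ℂ_[p])‖ = 1) :
    ∃ g : PadicAlgCl p ≃ₐ[F] PadicAlgCl p, ∀ ζ : PadicAlgCl p, ζ ^ N = 1 →
      g ζ = ζ ^ baseCard p F := by
  have : IsGalois F (PadicAlgCl p) := isGalois_padicAlgCl
  have : NeZero N := ⟨ne_zero_of_norm_natCast_eq_one hN⟩
  obtain ⟨ξ, hξ⟩ := HasEnoughRootsOfUnity.exists_primitiveRoot (PadicAlgCl p) N
  let j : PadicAlgCl p →ₐ[F] ℂ_[p] := { algebraMap (PadicAlgCl p) ℂ_[p] with commutes' := hF }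
  have htame : IsTameRoot (j ξ) := ⟨N, hN, by rw [← map_pow, hξ.pow_eq_one, map_one]⟩
  have hroot := htame.aeval_minpoly_pow_baseCard (F := F)
  rw [minpoly.algHom_eq j j.injective, ← map_pow, Polynomial.aeval_algHom_apply,
    map_eq_zero] at hroot
  obtain ⟨g, hg⟩ := minpoly.exists_algEquiv_of_root
    (Algebra.IsAlgebraic.isAlgebraic (R := F) ξ) hroot
  refine ⟨g.symm, fun ζ hζ => ?_⟩
  obtain ⟨i, -, rfl⟩ := hξ.eq_pow_of_pow_eq_one hζ
  rw [map_pow, ← hg, AlgEquiv.symm_apply_apply, ← pow_mul, hg, ← pow_mul, mul_comm]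

lemma exists_galois_eq_pow_baseCard (hF : ∀ a : F,
    algebraMap (PadicAlgCl p) ℂ_[p] (algebraMap F (PadicAlgCl p) a) = algebraMap F ℂ_[p] a) :
    ∃ g : PadicAlgCl p ≃ₐ[F] PadicAlgCl p,
      ∀ (N : ℕ) (ζ : PadicAlgCl p), ‖(N : ℂ_[p])‖ = 1 → ζ ^ N = 1 → g ζ = ζ ^ baseCard p F := by
  have : IsGalois F (PadicAlgCl p) := isGalois_padicAlgCl
  let S : {N : ℕ // ‖(N : ℂ_[p])‖ = 1} → Set (PadicAlgCl p ≃ₐ[F] PadicAlgCl p) := fun N =>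
    ⋂ (ζ : PadicAlgCl p) (_ : ζ ^ (N : ℕ) = 1), {g | g ζ = ζ ^ baseCard p F}
  have hS : ∀ N g, g ∈ S N ↔ ∀ ζ : PadicAlgCl p, ζ ^ (N : ℕ) = 1 → g ζ = ζ ^ baseCard p F := by
    simp [S]
  have hclosed : ∀ N, IsClosed (S N) := fun N =>
    isClosed_iInter fun ζ => isClosed_iInter fun _ => isClosed_setOf_apply_eq _ _
  have hdirected : Directed (· ⊇ ·) S := fun N M => by
    have hNM : ‖((N * M : ℕ) : ℂ_[p])‖ = 1 := by rw [Nat.cast_mul, norm_mul, N.2, M.2, one_mul]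
    refine ⟨⟨N * M, hNM⟩, fun g hg => ?_, fun g hg => ?_⟩
    · exact (hS _ _).2 fun ζ hζ => (hS ⟨N * M, hNM⟩ g).1 hg ζ (by rw [pow_mul, hζ, one_pow])
    · exact (hS _ _).2 fun ζ hζ => (hS ⟨N * M, hNM⟩ g).1 hg ζ (by rw [pow_mul', hζ, one_pow])
  have : Nonempty {N : ℕ // ‖(N : ℂ_[p])‖ = 1} := ⟨⟨1, by simp⟩⟩
  obtain ⟨g, hg⟩ := IsCompact.nonempty_iInter_of_directed_nonempty_isCompact_isClosed S hdirected
    (fun N => by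
      obtain ⟨g, hg⟩ := exists_galois_eq_pow_baseCard_of_pow_eq_one hF N.2
      exact ⟨g, (hS _ _).2 hg⟩)
    (fun N => (hclosed N).isCompact) hclosed
  exact ⟨g, fun N ζ hN => (hS ⟨N, hN⟩ g).1 (Set.mem_iInter.1 hg _) ζ⟩

end Galois

variable (p F) in
lemma exists_algHom_padicAlgCl : ∃ ι : F →ₐ[ℚ_[p]] PadicAlgCl p, ∀ a,
    algebraMap (PadicAlgCl p) ℂ_[p] (ι a) = algebraMap F ℂ_[p] a := by
  let j := IsScalarTower.toAlgHom ℚ_[p] (PadicAlgCl p) ℂ_[p]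
  let i := IsScalarTower.toAlgHom ℚ_[p] F ℂ_[p]
  have hrange : ∀ a, i a ∈ j.range := fun a =>
    exists_coe_of_isIntegral ((IsIntegral.of_finite ℚ_[p] a).algebraMap)
  refine ⟨(AlgEquiv.ofInjective j j.injective).symm.toAlgHom.comp (i.codRestrict j.range hrange),
    fun a => ?_⟩
  exact congrArg Subtype.val
    ((AlgEquiv.ofInjective j j.injective).apply_symm_apply (i.codRestrict j.range hrange a))

variable (p F) in
lemma exists_frobenius : ∃ σ : ℂ_[p] ≃ₐ[F] ℂ_[p], (∀ x, ‖σ x‖ = ‖x‖) ∧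
    ∀ ζ : ℂ_[p], IsTameRoot ζ → σ ζ = ζ ^ baseCard p F := by
  obtain ⟨ι, hι⟩ := exists_algHom_padicAlgCl p F
  let _ : Algebra F (PadicAlgCl p) := ι.toRingHom.toAlgebra
  have : IsScalarTower ℚ_[p] F (PadicAlgCl p) :=
    IsScalarTower.of_algebraMap_eq fun a => (ι.commutes a).symm
  obtain ⟨g, hg⟩ := exists_galois_eq_pow_baseCard hι
  obtain ⟨σ, hσ, hσg⟩ := exists_isometric_extension hι g
  refine ⟨σ, hσ, fun ζ hζ => ?_⟩
  obtain ⟨b, rfl⟩ := exists_coe_of_isIntegral (hζ.isIntegral ℚ_[p])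
  obtain ⟨N, hN, hbN⟩ := hζ
  have hb : b ^ N = 1 := (algebraMap (PadicAlgCl p) ℂ_[p]).injective (by
    rw [map_pow, map_one]
    exact hbN)
  rw [hσg, hg N b hN hb, PadicComplex.coe_eq, map_pow]
  rfl

end Frobenius

section FrobeniusPowers

variable {p : ℕ} [Fact p.Prime] {F : Type*} [Field F] [Algebra F ℂ_[p]]

/-- An isometric automorphism of `ℂ_p` that acts on roots of unity of order prime to `p`, and hence
on the residue field, as `x ↦ x ^ Q`. -/
structure IsFrobeniusPower (τ : ℂ_[p] ≃ₐ[F] ℂ_[p]) (Q : ℕ) : Prop where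
  norm_apply : ∀ x, ‖τ x‖ = ‖x‖
  apply_tameRoot : ∀ ζ, IsTameRoot ζ → τ ζ = ζ ^ Q

namespace IsFrobeniusPower

variable {τ : ℂ_[p] ≃ₐ[F] ℂ_[p]} {Q : ℕ}

lemma pow (h : IsFrobeniusPower τ Q) (n : ℕ) : IsFrobeniusPower (τ ^ n) (Q ^ n) := by
  induction n with
  | zero => exact ⟨fun x => by simp, fun ζ _ => by simp⟩
  | succ n ih =>
    refine ⟨fun x => ?_, fun ζ hζ => ?_⟩
    · rw [pow_succ, AlgEquiv.mul_apply, ih.norm_apply, h.norm_apply]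
    · rw [pow_succ, AlgEquiv.mul_apply, h.apply_tameRoot ζ hζ, map_pow, ih.apply_tameRoot ζ hζ,
        pow_succ, pow_mul]

lemma norm_sub_pow_lt_one (h : IsFrobeniusPower τ Q) (hQ : Q ≠ 0) {a : ℂ_[p]} (ha : ‖a‖ ≤ 1) :
    ‖τ a - a ^ Q‖ < 1 := by
  rcases ha.lt_or_eq with ha' | ha'
  · refine norm_sub_lt_trans (y := 0) ?_ ?_
    · rwa [sub_zero, h.norm_apply]
    · rw [zero_sub, norm_neg, norm_pow]
      exact pow_lt_one₀ (norm_nonneg _) ha' hQ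
  · obtain ⟨ζ, hζ, hlt⟩ := exists_isTameRoot ha'
    refine norm_sub_lt_trans (y := τ ζ) (by rwa [← map_sub, h.norm_apply]) ?_
    rw [h.apply_tameRoot ζ hζ]
    exact norm_pow_sub_pow_lt_one hζ.norm_eq_one.le (by rwa [norm_sub_rev]) Q

end IsFrobeniusPower

end FrobeniusPowers

/-! ### The maximal unramified extension and its completion -/

section Unramified

lemma pow_eq_self_iff_pow_sub_one_eq_one {K : Type*} [Field K] {x : K} (hx : x ≠ 0) {n : ℕ}
    (hn : 0 < n) : x ^ n = x ↔ x ^ (n - 1) = 1 := by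
  rw [← mul_eq_right₀ hx, pow_sub_one_mul hn.ne']

lemma exists_isTameRoot_forall_mem_range_pow {K : Type*} [NormedField K] [IsAlgClosed K]
    (T : Finset K) (hT : ∀ t ∈ T, IsTameRoot t) :
    ∃ ζ : K, IsTameRoot ζ ∧ ∀ t ∈ T, ∃ i : ℕ, ζ ^ i = t := by
  classical
  obtain ⟨N, hN, h⟩ : ∃ N : ℕ, ‖(N : K)‖ = 1 ∧ ∀ t ∈ T, t ^ N = 1 := by
    induction T using Finset.induction_on with
    | empty => exact ⟨1, by simp, by simp⟩
    | insert a T _ ih =>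
      obtain ⟨N, hN, h⟩ := ih fun t ht => hT t (Finset.mem_insert_of_mem ht)
      obtain ⟨M, hM, ha⟩ := hT a (Finset.mem_insert_self a T)
      refine ⟨N * M, by rw [Nat.cast_mul, norm_mul, hN, hM, one_mul], fun t ht => ?_⟩
      rcases Finset.mem_insert.1 ht with rfl | ht
      · rw [pow_mul', ha, one_pow]
      · rw [pow_mul, h t ht, one_pow]
  have : NeZero N := ⟨ne_zero_of_norm_natCast_eq_one hN⟩
  have : NeZero (N : K) := ⟨norm_ne_zero_iff.1 (by rw [hN]; exact one_ne_zero)⟩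
  obtain ⟨ζ, hζ⟩ := HasEnoughRootsOfUnity.exists_primitiveRoot K N
  refine ⟨ζ, ⟨N, hN, hζ.pow_eq_one⟩, fun t ht => ?_⟩
  obtain ⟨i, -, hi⟩ := hζ.eq_pow_of_pow_eq_one (h t ht)
  exact ⟨i, hi⟩

variable {p : ℕ} [Fact p.Prime] {F : Type*} [Field F] [Algebra F ℂ_[p]]

lemma isClosed_completedUnramified : IsClosed (completedUnramified p F : Set ℂ_[p]) :=
  isClosed_closure (s := (maxUnramified p F : Set ℂ_[p]))

lemma le_maxUnramified (K : IntermediateField F ℂ_[p]) [hK : FiniteDimensional F K]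
    (h : IsUnramified K) : K ≤ maxUnramified p F :=
  le_iSup₂_of_le (f := fun (K : IntermediateField F ℂ_[p])
      (_ : FiniteDimensional F K ∧ IsUnramified K) => K) K ⟨hK, h⟩ le_rfl

lemma isUnramified_bot : IsUnramified (⊥ : IntermediateField F ℂ_[p]) := by
  intro x hx
  obtain ⟨y, rfl⟩ := IntermediateField.mem_bot.1 hx
  exact ⟨y, rfl⟩

lemma exists_isTameRoot_mem_adjoin {x : ℂ_[p]}
    (hx : x ∈ IntermediateField.adjoin F {ζ : ℂ_[p] | IsTameRoot ζ}) :
    ∃ ζ, IsTameRoot ζ ∧ x ∈ IntermediateField.adjoin F {ζ} := by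
  obtain ⟨T, hT, hxT⟩ := IntermediateField.exists_finset_of_mem_adjoin hx
  obtain ⟨ζ, hζ, hζT⟩ := exists_isTameRoot_forall_mem_range_pow T fun t ht => hT ht
  refine ⟨ζ, hζ, IntermediateField.adjoin_le_iff.2 (fun t ht => ?_) hxT⟩
  obtain ⟨i, rfl⟩ := hζT t ht
  exact pow_mem (IntermediateField.mem_adjoin_simple_self F ζ) i

variable [Algebra ℚ_[p] F] [FiniteDimensional ℚ_[p] F] [IsScalarTower ℚ_[p] F ℂ_[p]]

lemma one_lt_baseCard : 1 < baseCard p F := one_lt_resCard _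

lemma IsTameRoot.mem_maxUnramified {ζ : ℂ_[p]} (hζ : IsTameRoot ζ) : ζ ∈ maxUnramified p F := by
  have := hζ.finiteDimensional F
  exact le_maxUnramified _ (hζ.isUnramified F) (IntermediateField.mem_adjoin_simple_self F ζ)

lemma IsTameRoot.mem_completedUnramified {ζ : ℂ_[p]} (hζ : IsTameRoot ζ) :
    ζ ∈ completedUnramified p F :=
  subset_closure (hζ.mem_maxUnramified (F := F))

namespace IsUnramified

variable {M : IntermediateField F ℂ_[p]} [FiniteDimensional F M]

lemma exists_eq_adjoin (hM : IsUnramified M) : ∃ ζ : ℂ_[p], IsTameRoot ζ ∧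
    IsPrimitiveRoot ζ (resCard M - 1) ∧ M = IntermediateField.adjoin F {ζ} := by
  have hq := norm_natCast_resCard_sub_one M
  have hpow : ∀ ξ : ℂ_[p], IsTameRoot ξ → (ξ ∈ M ↔ ξ ^ (resCard M - 1) = 1) := fun ξ hξ => by
    rw [hξ.mem_iff M, pow_eq_self_iff_pow_sub_one_eq_one hξ.ne_zero
      (zero_lt_one.trans (one_lt_resCard M))]
  have : NeZero (resCard M - 1) := ⟨ne_zero_of_norm_natCast_eq_one hq⟩
  obtain ⟨ζ, hζ⟩ := HasEnoughRootsOfUnity.exists_primitiveRoot ℂ_[p] (resCard M - 1)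
  have htame : IsTameRoot ζ := ⟨_, hq, hζ.pow_eq_one⟩
  have hle : IntermediateField.adjoin F {ζ} ≤ M :=
    IntermediateField.adjoin_simple_le_iff.2 ((hpow ζ htame).2 hζ.pow_eq_one)
  refine ⟨ζ, htame, hζ, le_antisymm (fun x hx => ?_) hle⟩
  have := htame.finiteDimensional F
  refine mem_of_forall_exists_norm_sub_lt_one _ (fun y hy => ?_) fun y hy c hc hn => ?_
  · obtain ⟨b, hb⟩ := hM _ (sub_mem hx (hle hy))
    exact ⟨_, IntermediateField.algebraMap_mem _ b, hb⟩
  · obtain ⟨ξ, hξM, hξ, hlt⟩ :=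
      exists_isTameRoot_mem (mul_mem (hle hc) (sub_mem hx (hle hy))) hn
    obtain ⟨i, -, rfl⟩ := hζ.eq_pow_of_pow_eq_one ((hpow ξ hξ).1 hξM)
    exact ⟨_, pow_mem (IntermediateField.mem_adjoin_simple_self F ζ) i, hlt⟩

protected lemma isGalois (hM : IsUnramified M) : IsGalois F M := by
  obtain ⟨ζ, hζ, -, h⟩ := hM.exists_eq_adjoin
  rw [h]
  exact hζ.isGalois F

end IsUnramified

lemma maxUnramified_eq_adjoin :
    maxUnramified p F = IntermediateField.adjoin F {ζ : ℂ_[p] | IsTameRoot ζ} := by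
  refine le_antisymm (iSup₂_le fun M hM => ?_)
    (IntermediateField.adjoin_le_iff.2 fun ζ hζ => IsTameRoot.mem_maxUnramified hζ)
  have := hM.1
  obtain ⟨ζ, hζ, -, h⟩ := hM.2.exists_eq_adjoin
  rw [h]
  exact IntermediateField.adjoin.mono _ _ _ (Set.singleton_subset_iff.2 hζ)

lemma exists_norm_eq_of_mem_completedUnramified {x : ℂ_[p]} (hx : x ∈ completedUnramified p F) :
    ∃ b : F, ‖x‖ = ‖algebraMap F ℂ_[p] b‖ := by
  by_cases hx0 : x = 0
  · exact ⟨0, by simp [hx0]⟩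
  obtain ⟨y, hy, hxy⟩ := Metric.mem_closure_iff.1 hx ‖x‖ (norm_pos_iff.2 hx0)
  replace hy : y ∈ maxUnramified p F := hy
  rw [maxUnramified_eq_adjoin] at hy
  obtain ⟨ζ, hζ, hyζ⟩ := exists_isTameRoot_mem_adjoin hy
  obtain ⟨b, hb⟩ := hζ.isUnramified F y hyζ
  rw [dist_eq_norm] at hxy
  exact ⟨b, by rw [← hb, norm_eq_of_norm_sub_lt hxy]⟩

lemma map_mem_completedUnramified {τ : ℂ_[p] ≃ₐ[F] ℂ_[p]} (hτ : ∀ x, ‖τ x‖ = ‖x‖) {x : ℂ_[p]}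
    (hx : x ∈ completedUnramified p F) : τ x ∈ completedUnramified p F := by
  have hcont : Continuous τ := (AddMonoidHomClass.isometry_of_norm τ hτ).continuous
  have hle : maxUnramified p F ≤ (maxUnramified p F).comap τ.toAlgHom := by
    nth_rw 1 [maxUnramified_eq_adjoin]
    exact IntermediateField.adjoin_le_iff.2 fun ζ hζ => IsTameRoot.mem_maxUnramified (hζ.map τ)
  exact map_mem_closure hcont hx fun y hy => hle hy

section Frobenius

variable {σ : ℂ_[p] ≃ₐ[F] ℂ_[p]}

namespace IsUnramified

variable {M : IntermediateField F ℂ_[p]} [FiniteDimensional F M]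

lemma apply_eq_self (hM : IsUnramified M) {Q : ℕ} (hσ : IsFrobeniusPower σ Q)
    (hQ : ∀ ζ ∈ M, IsTameRoot ζ → ζ ^ Q = ζ) {x : ℂ_[p]} (hx : x ∈ M) : σ x = x := by
  obtain ⟨ζ, hζ, -, h⟩ := hM.exists_eq_adjoin
  have hζM : ζ ∈ M := h ▸ IntermediateField.mem_adjoin_simple_self F ζ
  have hhom : σ.toAlgHom.comp M.val = M.val := by
    refine IntermediateField.algHom_ext_of_eq_adjoin F h ?_
    rintro y hy
    obtain rfl := Set.mem_singleton_iff.1 hy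
    exact (hσ.apply_tameRoot _ hζ).trans (hQ _ hζM hζ)
  exact DFunLike.congr_fun hhom ⟨x, hx⟩

lemma mem_of_apply_eq_self (hM : IsUnramified M) (hσ : IsFrobeniusPower σ (resCard M)) {x : ℂ_[p]}
    (hx : x ∈ completedUnramified p F) (hfix : σ x = x) : x ∈ M := by
  have hMfix : ∀ y ∈ M, σ y = y := fun y hy =>
    hM.apply_eq_self hσ (fun ζ hζM hζ => (hζ.mem_iff M).1 hζM) hy
  have hle := le_completedUnramified M hM
  refine mem_of_forall_exists_norm_sub_lt_one M (fun y hy => ?_) fun y hy c hc hn => ?_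
  · obtain ⟨b, hb⟩ := exists_norm_eq_of_mem_completedUnramified (sub_mem hx (hle hy))
    exact ⟨_, IntermediateField.algebraMap_mem _ b, hb⟩
  · obtain ⟨ζ, hζ, hlt⟩ := exists_isTameRoot hn
    refine ⟨ζ, (hζ.mem_iff M).2 ?_, hlt⟩
    have hfix' : σ (c * (x - y)) = c * (x - y) := by
      rw [map_mul, map_sub, hMfix c hc, hMfix y hy, hfix]
    have hσlt : ‖σ ζ - c * (x - y)‖ < 1 := by
      rwa [← hfix', ← map_sub, hσ.norm_apply, norm_sub_rev]
    rw [← hσ.apply_tameRoot ζ hζ]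
    exact (hζ.map σ).eq_of_norm_sub_lt_one hζ (norm_sub_lt_trans hσlt hlt)

end IsUnramified

lemma exists_algebraMap_eq_of_apply_eq_self (hσ : IsFrobeniusPower σ (baseCard p F)) {x : ℂ_[p]}
    (hx : x ∈ completedUnramified p F) (hfix : σ x = x) : ∃ b : F, algebraMap F ℂ_[p] b = x :=
  IntermediateField.mem_bot.1 (isUnramified_bot.mem_of_apply_eq_self hσ hx hfix)

namespace IsUnramified

variable {M : IntermediateField F ℂ_[p]} [FiniteDimensional F M] [IsGalois F M]

lemma zpowers_restrictNormal_eq_top (hM : IsUnramified M)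
    (hσ : IsFrobeniusPower σ (baseCard p F)) : Subgroup.zpowers (σ.restrictNormal M) = ⊤ := by
  have hfixed : IntermediateField.fixedField (Subgroup.zpowers (σ.restrictNormal M)) = ⊥ := by
    refine eq_bot_iff.2 fun x hx => ?_
    have hx' : σ.restrictNormal M x = x := hx ⟨_, Subgroup.mem_zpowers _⟩
    have hσx : σ (x : ℂ_[p]) = x :=
      (AlgEquiv.restrictNormal_commutes σ M x).symm.trans (congrArg _ hx')
    obtain ⟨b, hb⟩ :=
      exists_algebraMap_eq_of_apply_eq_self hσ (le_completedUnramified M hM x.2) hσx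
    exact IntermediateField.mem_bot.2 ⟨b, Subtype.ext hb⟩
  apply Subgroup.eq_top_of_card_eq
  rw [← IntermediateField.finrank_fixedField_eq_card, hfixed, IsGalois.card_aut_eq_finrank]
  exact IntermediateField.finrank_bot'

lemma resCard_eq_pow_finrank (hM : IsUnramified M) (hσ : IsFrobeniusPower σ (baseCard p F)) :
    resCard M = baseCard p F ^ Module.finrank F M := by
  have horder : orderOf (σ.restrictNormal M) = Module.finrank F M := by
    rw [← Nat.card_zpowers, hM.zpowers_restrictNormal_eq_top hσ, Subgroup.card_top,
      IsGalois.card_aut_eq_finrank]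
  have hcomm : ∀ (n : ℕ) (x : M),
      (((σ.restrictNormal M ^ n) x : M) : ℂ_[p]) = (σ ^ n) (x : ℂ_[p]) := fun n x => by
    have hpow : σ.restrictNormal M ^ n = (σ ^ n).restrictNormal M :=
      (map_pow (AlgEquiv.restrictNormalHom M) σ n).symm
    rw [hpow]
    exact AlgEquiv.restrictNormal_commutes (σ ^ n) M x
  obtain ⟨s, hs₀, hs : resCard M = baseCard p F ^ s⟩ :=
    exists_resCard_eq_resCard_pow M (bot_le : (⊥ : IntermediateField F ℂ_[p]) ≤ M)
  have hdvd : Module.finrank F M ∣ s := by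
    rw [← horder]
    refine orderOf_dvd_of_pow_eq_one (AlgEquiv.ext fun x => Subtype.ext ?_)
    rw [hcomm]
    exact hM.apply_eq_self (hσ.pow s) (fun ζ hζM hζ => hs ▸ (hζ.mem_iff M).1 hζM) x.2
  have hle : s ≤ Module.finrank F M := by
    obtain ⟨ζ, hζ, hprim, h⟩ := hM.exists_eq_adjoin
    have hζM : ζ ∈ M := h ▸ IntermediateField.mem_adjoin_simple_self F ζ
    have hbase : 1 < baseCard p F := one_lt_baseCard
    have hq := Nat.one_lt_pow (Module.finrank_pos (R := F) (M := M)).ne' hbase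
    have hpow : ζ ^ (baseCard p F ^ Module.finrank F M) = ζ := by
      rw [← (hσ.pow _).apply_tameRoot ζ hζ, ← horder, ← hcomm _ ⟨ζ, hζM⟩, pow_orderOf_eq_one]
      rfl
    have hsub : resCard M - 1 ≤ baseCard p F ^ Module.finrank F M - 1 :=
      Nat.le_of_dvd (Nat.sub_pos_of_lt hq) (hprim.dvd_of_pow_eq_one _
        ((pow_eq_self_iff_pow_sub_one_eq_one hζ.ne_zero (zero_lt_one.trans hq)).1 hpow))
    rw [hs] at hsub
    exact (Nat.pow_le_pow_iff_right hbase).1 (by lia)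
  rw [hs, hle.antisymm (Nat.le_of_dvd hs₀.bot_lt hdvd)]

end IsUnramified

end Frobenius

end Unramified

/-! ### Surjectivity of `φ - 1` on units -/

section SuccessiveApproximation

variable {G : Type*} [NormedAddCommGroup G]

lemma iterate_mem_and_norm_iterate_le {S : Set G} {r : G → G} {c : ℝ} (hc0 : 0 ≤ c)
    (hr : ∀ y ∈ S, r y ∈ S ∧ ‖r y‖ ≤ c * ‖y‖) {e : G} (he : e ∈ S) (n : ℕ) :
    r^[n] e ∈ S ∧ ‖r^[n] e‖ ≤ c ^ n * ‖e‖ := by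
  induction n with
  | zero => simpa using he
  | succ n ih =>
    rw [Function.iterate_succ_apply', pow_succ', mul_assoc]
    exact ⟨(hr _ ih.1).1, (hr _ ih.1).2.trans (mul_le_mul_of_nonneg_left ih.2 hc0)⟩

lemma exists_apply_eq_of_forall_exists_norm_sub_le [IsUltrametricDist G] [CompleteSpace G]
    {S : AddSubgroup G} (hS : IsClosed (S : Set G)) {f : G →+ G} (hf : Continuous f)
    (hfS : ∀ x ∈ S, f x ∈ S) {c : ℝ} (hc0 : 0 ≤ c) (hc : c < 1)
    (h : ∀ e ∈ S, ∃ x ∈ S, ‖x‖ ≤ ‖e‖ ∧ ‖e - f x‖ ≤ c * ‖e‖) {e : G} (he : e ∈ S) :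
    ∃ x ∈ S, ‖x‖ ≤ ‖e‖ ∧ f x = e := by
  choose! g hgS hg hgc using h
  let r : G → G := fun y => y - f (g y)
  have hr := iterate_mem_and_norm_iterate_le (S := S) (r := r) hc0
    (fun y hy => ⟨sub_mem hy (hfS _ (hgS y hy)), hgc y hy⟩) he
  have hgr (n : ℕ) : ‖g (r^[n] e)‖ ≤ c ^ n * ‖e‖ := (hg _ (hr n).1).trans (hr n).2
  have hpart (n : ℕ) : f (∑ i ∈ Finset.range n, g (r^[i] e)) = e - r^[n] e := by
    rw [map_sum]
    refine (Finset.sum_congr rfl fun i _ => ?_).trans (Finset.sum_range_sub' (fun i => r^[i] e) n)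
    rw [Function.iterate_succ_apply', sub_sub_cancel]
  have hlim : Filter.Tendsto (fun n => r^[n] e) Filter.atTop (nhds 0) := by
    refine squeeze_zero_norm (fun n => (hr n).2) ?_
    simpa using (tendsto_pow_atTop_nhds_zero_of_lt_one hc0 hc).mul_const ‖e‖
  have hsum : Summable fun n => g (r^[n] e) :=
    .of_norm_bounded ((summable_geometric_of_lt_one hc0 hc).mul_right _) hgr
  have hx := hsum.hasSum.tendsto_sum_nat
  refine ⟨∑' n, g (r^[n] e), ?_, ?_, ?_⟩
  · exact hS.mem_of_tendsto hx (.of_forall fun n => sum_mem fun i _ => hgS _ (hr i).1)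
  · refine le_of_tendsto hx.norm (.of_forall fun n => ?_)
    exact IsUltrametricDist.norm_sum_le_of_forall_le_of_nonneg (norm_nonneg _) fun i _ =>
      (hgr i).trans (mul_le_of_le_one_left (norm_nonneg _) (pow_le_one₀ hc0 hc.le))
  · refine tendsto_nhds_unique ((hf.tendsto _).comp hx) ?_
    simpa only [Function.comp_def, hpart, sub_zero] using tendsto_const_nhds.sub hlim

end SuccessiveApproximation

section Lang

open Polynomial in
lemma exists_norm_le_one_mul_pow_sub_mul_eq_one {K : Type*} [NormedField K] [IsUltrametricDist K]
    [IsAlgClosed K] {w u : K} (hw : ‖w‖ = 1) (hu : ‖u‖ ≤ 1) {Q : ℕ} (hQ : 1 < Q) :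
    ∃ a : K, ‖a‖ ≤ 1 ∧ w * a ^ Q - u * a = 1 := by
  have hw0 : w ≠ 0 := norm_ne_zero_iff.1 (hw.trans_ne one_ne_zero)
  have hdeg : (C w * X ^ Q - (C u * X + C 1)).degree = (Q : WithBot ℕ) := by
    rw [degree_sub_eq_left_of_degree_lt] <;> rw [degree_C_mul_X_pow _ hw0]
    exact degree_linear_le.trans_lt (by exact_mod_cast hQ)
  obtain ⟨a, ha⟩ := IsAlgClosed.exists_root (C w * X ^ Q - (C u * X + C 1)) (by
    rw [hdeg]
    exact_mod_cast (zero_lt_one.trans hQ).ne')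
  have hroot : w * a ^ Q = u * a + 1 := sub_eq_zero.1 (by simpa [IsRoot.def] using ha)
  refine ⟨a, ?_, by rw [hroot, add_sub_cancel_left]⟩
  by_contra! hlt
  have hle : ‖a‖ ^ Q ≤ ‖a‖ :=
    calc ‖a‖ ^ Q = ‖u * a + 1‖ := by rw [← hroot, norm_mul, norm_pow, hw, one_mul]
      _ ≤ max ‖u * a‖ ‖(1 : K)‖ := IsUltrametricDist.norm_add_le_max _ _
      _ ≤ ‖a‖ := max_le (by
          rw [norm_mul]
          exact mul_le_of_le_one_left (norm_nonneg a) hu) (norm_one.trans_le hlt.le)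
  exact hle.not_gt (lt_self_pow₀ hlt hQ)

variable {p : ℕ} [Fact p.Prime]

lemma exists_mem_norm_sub_lt_one {S : Subfield ℂ_[p]} (htame : ∀ ζ, IsTameRoot ζ → ζ ∈ S)
    {a : ℂ_[p]} (ha : ‖a‖ ≤ 1) : ∃ b ∈ S, ‖b‖ ≤ 1 ∧ ‖a - b‖ < 1 := by
  rcases ha.lt_or_eq with ha' | ha'
  · exact ⟨0, zero_mem _, by simp, by simpa using ha'⟩
  · obtain ⟨ζ, hζ, h⟩ := exists_isTameRoot ha'
    exact ⟨ζ, htame ζ hζ, hζ.norm_eq_one.le, h⟩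

namespace IsFrobeniusPower

variable {F : Type*} [Field F] [Algebra F ℂ_[p]] {φ : ℂ_[p] ≃ₐ[F] ℂ_[p]} {Q : ℕ} {u : ℂ_[p]}

lemma exists_isTameRoot_norm_apply_sub_mul_lt_one (hφ : IsFrobeniusPower φ Q) (hQ : 1 < Q)
    (hu : ‖u‖ = 1) : ∃ x, IsTameRoot x ∧ ‖φ x - u * x‖ < 1 := by
  obtain ⟨y, hy⟩ := IsAlgClosed.exists_pow_nat_eq u (Nat.sub_pos_of_lt hQ)
  have hy1 : ‖y‖ = 1 := by
    rw [← pow_eq_one_iff_of_nonneg (norm_nonneg y) (Nat.sub_pos_of_lt hQ).ne', ← norm_pow, hy, hu]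
  obtain ⟨x, hx, hyx⟩ := exists_isTameRoot hy1
  refine ⟨x, hx, norm_sub_lt_trans (hφ.norm_sub_pow_lt_one hQ.ne_bot hx.norm_eq_one.le) ?_⟩
  refine norm_sub_lt_trans (norm_pow_sub_pow_lt_one hx.norm_eq_one.le
    (by rwa [norm_sub_rev]) Q) ?_
  rwa [← Nat.sub_add_cancel hQ.le, pow_succ, hy, ← mul_sub, norm_mul, hu, one_mul]

lemma exists_mem_norm_mul_apply_sub_mul_sub_one_lt_one (hφ : IsFrobeniusPower φ Q) (hQ : 1 < Q)
    {S : Subfield ℂ_[p]} (htame : ∀ ζ, IsTameRoot ζ → ζ ∈ S) {w : ℂ_[p]} (hw : ‖w‖ = 1)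
    (hu : ‖u‖ ≤ 1) : ∃ b ∈ S, ‖b‖ ≤ 1 ∧ ‖w * φ b - u * b - 1‖ < 1 := by
  obtain ⟨a, ha, hroot⟩ := exists_norm_le_one_mul_pow_sub_mul_eq_one hw hu hQ
  obtain ⟨b, hbS, hb, hab⟩ := exists_mem_norm_sub_lt_one htame ha
  have hφb : ‖φ b - a ^ Q‖ < 1 := norm_sub_lt_trans (hφ.norm_sub_pow_lt_one hQ.ne_bot hb)
    (norm_pow_sub_pow_lt_one hb (by rwa [norm_sub_rev]) Q)
  refine ⟨b, hbS, hb, ?_⟩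
  calc ‖w * φ b - u * b - 1‖ = ‖w * (φ b - a ^ Q) + u * (a - b)‖ := by
        congr 1
        linear_combination hroot
    _ ≤ max ‖w * (φ b - a ^ Q)‖ ‖u * (a - b)‖ := IsUltrametricDist.norm_add_le_max _ _
    _ < 1 := by
        rw [norm_mul, norm_mul, hw, one_mul]
        exact max_lt hφb (mul_lt_one_of_nonneg_of_lt_one_right hu (norm_nonneg _) hab)

variable {S : Subfield ℂ_[p]} (hφS : ∀ x ∈ S, φ x ∈ S) {c : ℝ}

include hφS

lemma exists_mem_norm_sub_apply_sub_mul_le (hφ : IsFrobeniusPower φ Q) (hQ : 1 < Q)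
    (htame : ∀ ζ, IsTameRoot ζ → ζ ∈ S) (hdisc : ∀ x ∈ S, ‖x‖ < 1 → ‖x‖ ≤ c)
    (hu : u ∈ S) (hu1 : ‖u‖ ≤ 1) {e : ℂ_[p]} (he : e ∈ S) :
    ∃ x ∈ S, ‖x‖ ≤ ‖e‖ ∧ ‖e - (φ x - u * x)‖ ≤ c * ‖e‖ := by
  rcases eq_or_ne e 0 with rfl | he0
  · exact ⟨0, zero_mem S, le_rfl, by simp⟩
  have hwS : φ e / e ∈ S := div_mem (hφS e he) he
  have hw : ‖φ e / e‖ = 1 := by rw [norm_div, hφ.norm_apply, div_self (norm_ne_zero_iff.2 he0)]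
  obtain ⟨b, hbS, hb, hlt⟩ := hφ.exists_mem_norm_mul_apply_sub_mul_sub_one_lt_one hQ htame hw hu1
  have hmem : φ e / e * φ b - u * b - 1 ∈ S :=
    sub_mem (sub_mem (mul_mem hwS (hφS b hbS)) (mul_mem hu hbS)) (one_mem S)
  refine ⟨e * b, mul_mem he hbS, ?_, ?_⟩
  · rw [norm_mul]
    exact mul_le_of_le_one_right (norm_nonneg _) hb
  · have hfactor : φ (e * b) - u * (e * b) - e = (φ e / e * φ b - u * b - 1) * e := by
      rw [map_mul]
      field_simp
    rw [norm_sub_rev, hfactor, norm_mul]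
    exact mul_le_mul_of_nonneg_right (hdisc _ hmem hlt) (norm_nonneg _)

variable (hS : IsClosed (S : Set ℂ_[p])) (hc : c < 1)

include hS hc

lemma exists_apply_sub_mul_eq (hφ : IsFrobeniusPower φ Q) (hQ : 1 < Q)
    (htame : ∀ ζ, IsTameRoot ζ → ζ ∈ S) (hdisc : ∀ x ∈ S, ‖x‖ < 1 → ‖x‖ ≤ c)
    (hu : u ∈ S) (hu1 : ‖u‖ ≤ 1) {e : ℂ_[p]} (he : e ∈ S) :
    ∃ x ∈ S, ‖x‖ ≤ ‖e‖ ∧ φ x - u * x = e := by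
  have hc0 : 0 ≤ c := by simpa using hdisc 0 S.zero_mem (by simp)
  have hcont : Continuous φ := (AddMonoidHomClass.isometry_of_norm φ hφ.norm_apply).continuous
  let f : ℂ_[p] →+ ℂ_[p] := (φ : ℂ_[p] →+ ℂ_[p]) - AddMonoidHom.mulLeft u
  exact exists_apply_eq_of_forall_exists_norm_sub_le (S := S.toSubring.toAddSubgroup) (f := f) hS
    (hcont.sub (continuous_const_mul u)) (fun x hx => S.sub_mem (hφS x hx) (S.mul_mem hu hx))
    hc0 hc (fun _ he => hφ.exists_mem_norm_sub_apply_sub_mul_le hφS hQ htame hdisc hu hu1 he) he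

lemma exists_apply_eq_mul (hφ : IsFrobeniusPower φ Q) (hQ : 1 < Q)
    (htame : ∀ ζ, IsTameRoot ζ → ζ ∈ S) (hdisc : ∀ x ∈ S, ‖x‖ < 1 → ‖x‖ ≤ c)
    (hu : u ∈ S) (hu1 : ‖u‖ = 1) : ∃ x ∈ S, ‖x‖ = 1 ∧ φ x = u * x := by
  obtain ⟨x, hx, hlt⟩ := hφ.exists_isTameRoot_norm_apply_sub_mul_lt_one hQ hu1
  have hxS := htame x hx
  obtain ⟨z, hzS, hz, hfz⟩ := hφ.exists_apply_sub_mul_eq hφS hS hc hQ htame hdisc hu hu1.le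
    (sub_mem (hφS x hxS) (mul_mem hu hxS))
  refine ⟨x - z, sub_mem hxS hzS, ?_, ?_⟩
  · rw [norm_eq_of_norm_sub_lt (x := x), hx.norm_eq_one]
    rw [sub_sub_cancel, hx.norm_eq_one]
    exact hz.trans_lt hlt
  · rw [map_sub]
    linear_combination -hfz

end IsFrobeniusPower

end Lang

/-! ### The compositum of a finite extension with `L` -/

lemma normal_adjoin_of_normal {F : Type*} (L : Type*) {Ω : Type*} [Field F] [Field L] [Field Ω]
    [Algebra F L] [Algebra L Ω] [Algebra F Ω] [IsScalarTower F L Ω] (K : IntermediateField F Ω)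
    [Normal F K] : Normal L (IntermediateField.adjoin L (K : Set Ω)) := by
  let j : K →ₐ[F] IntermediateField.adjoin L (K : Set Ω) :=
    K.val.codRestrict ((IntermediateField.adjoin L (K : Set Ω)).restrictScalars F).toSubalgebra
      fun x => IntermediateField.subset_adjoin L _ x.2
  have hint (x : K) : IsIntegral L (x : Ω) :=
    ((Normal.isIntegral ‹_› x).map K.val).tower_top
  have hsplits (x : K) : ((minpoly L (x : Ω)).map
      (algebraMap L (IntermediateField.adjoin L (K : Set Ω)))).Splits := by
    have hK := (Normal.splits ‹Normal F K› x).of_algHom j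
    have hmin : minpoly F x = minpoly F (x : Ω) :=
      (minpoly.algebraMap_eq (algebraMap K Ω).injective x).symm
    rw [hmin, IsScalarTower.algebraMap_eq F L, ← Polynomial.map_map] at hK
    refine hK.of_dvd ?_ (Polynomial.map_dvd _ (minpoly.dvd_map_of_isScalarTower F L (x : Ω)))
    rw [Polynomial.map_map]
    exact Polynomial.map_ne_zero (hmin ▸ minpoly.ne_zero (Normal.isIntegral ‹_› x))
  have : Algebra.IsAlgebraic L (IntermediateField.adjoin L (K : Set Ω)) :=
    IntermediateField.isAlgebraic_adjoin fun y hy => hint ⟨y, hy⟩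
  refine normal_iff.2 fun x => ⟨Algebra.IsIntegral.isIntegral x, ?_⟩
  rw [IntermediateField.minpoly_eq]
  exact IntermediateField.splits_of_mem_adjoin L Ω (fun y hy => ⟨hint ⟨y, hy⟩, hsplits ⟨y, hy⟩⟩) x.2

section Compositum

variable {p : ℕ} [Fact p.Prime] {F : Type*} [Field F] [Algebra F ℂ_[p]]

section Normal

variable (K : IntermediateField F ℂ_[p]) [Normal F K] (τ : ℂ_[p] ≃ₐ[F] ℂ_[p])

lemma map_mem_of_normal {x : ℂ_[p]} (hx : x ∈ K) : τ x ∈ K := by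
  obtain ⟨y, hy⟩ : ∃ y : K, (y : ℂ_[p]) = τ x :=
    ⟨_, AlgEquiv.restrictNormal_commutes τ K ⟨x, hx⟩⟩
  exact hy ▸ y.2

lemma exists_pow_apply_eq_self [FiniteDimensional F K] :
    ∃ m : ℕ, m ≠ 0 ∧ ∀ x ∈ K, (τ ^ m) x = x := by
  refine ⟨Nat.card (K ≃ₐ[F] K), Nat.card_pos.ne', fun x hx => ?_⟩
  have hone : (τ ^ Nat.card (K ≃ₐ[F] K)).restrictNormal K = 1 :=
    (map_pow (AlgEquiv.restrictNormalHom K) τ _).trans pow_card_eq_one'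
  have hcomm := AlgEquiv.restrictNormal_commutes (τ ^ Nat.card (K ≃ₐ[F] K)) K ⟨x, hx⟩
  rw [hone] at hcomm
  exact hcomm.symm

end Normal

lemma algebraMap_mem_compositum (K : IntermediateField F ℂ_[p]) {x : ℂ_[p]}
    (hx : x ∈ completedUnramified p F) : x ∈ compositum K :=
  (compositum K).algebraMap_mem ⟨x, hx⟩

variable (p F) in
/-- The normed field structure on `L` inherited from `ℂ_p`. Nontriviality of the norm is what makes
finite-dimensional spaces over `L` complete. -/
abbrev completedUnramifiedNormedField : NontriviallyNormedField (completedUnramified p F) where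
  __ := SubfieldClass.toNormedField (completedUnramified p F)
  non_trivial := by
    have hp : (p : ℂ_[p]) ≠ 0 := Nat.cast_ne_zero.2 (Fact.out : p.Prime).ne_zero
    refine ⟨(p : completedUnramified p F)⁻¹, ?_⟩
    change 1 < ‖(p : ℂ_[p])⁻¹‖
    rw [norm_inv]
    exact (one_lt_inv₀ (norm_pos_iff.2 hp)).2 norm_prime_lt_one

section FiniteDimensional

variable (K : IntermediateField F ℂ_[p]) [FiniteDimensional F K]

lemma isClosed_compositum : IsClosed (compositum K : Set ℂ_[p]) := by
  let _ := completedUnramifiedNormedField p F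
  have : CompleteSpace (completedUnramified p F) := isClosed_completedUnramified.completeSpace_coe
  have : ContinuousSMul (completedUnramified p F) ℂ_[p] :=
    ⟨(continuous_subtype_val.comp continuous_fst).mul continuous_snd⟩
  have : FiniteDimensional (completedUnramified p F)
      (Subalgebra.toSubmodule (compositum K).toSubalgebra) :=
    inferInstanceAs (FiniteDimensional (completedUnramified p F) (compositum K))
  exact (Subalgebra.toSubmodule (compositum K).toSubalgebra).closed_of_finiteDimensional

lemma norm_galois_compositum (g : compositum K ≃ₐ[completedUnramified p F] compositum K)
    (x : compositum K) : ‖(g x : ℂ_[p])‖ = ‖(x : ℂ_[p])‖ := by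
  let _ := completedUnramifiedNormedField p F
  have : CompleteSpace (completedUnramified p F) := isClosed_completedUnramified.completeSpace_coe
  have : IsUltrametricDist (completedUnramified p F) :=
    ⟨fun x y z => IsUltrametricDist.dist_triangle_max (x : ℂ_[p]) y z⟩
  let ν : AbsoluteValue (compositum K) ℝ :=
    (NormedField.toAbsoluteValue ℂ_[p]).comp (compositum K).val.injective
  have hν := spectralNorm_unique_field_norm_ext (K := completedUnramified p F) (f := ν) fun _ => rfl
  exact (hν (g x)).trans ((spectralNorm_eq_of_equiv g x).symm.trans (hν x).symm)

instance [IsGalois F K] : IsGalois (completedUnramified p F) (compositum K) :=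
  have := normal_adjoin_of_normal (completedUnramified p F) K
  ⟨⟩

end FiniteDimensional

variable [Algebra ℚ_[p] F] [FiniteDimensional ℚ_[p] F] [IsScalarTower ℚ_[p] F ℂ_[p]]

lemma map_mem_compositum (K : IntermediateField F ℂ_[p]) [Normal F K] {τ : ℂ_[p] ≃ₐ[F] ℂ_[p]}
    (hτ : ∀ x, ‖τ x‖ = ‖x‖) {x : ℂ_[p]} (hx : x ∈ compositum K) : τ x ∈ compositum K := by
  induction hx using IntermediateField.adjoin_induction with
  | mem x hx => exact IntermediateField.subset_adjoin _ _ (map_mem_of_normal K τ hx)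
  | algebraMap x => exact algebraMap_mem_compositum K (map_mem_completedUnramified hτ x.2)
  | add x y _ _ hx hy => rw [map_add]; exact add_mem hx hy
  | inv x _ hx => rw [map_inv₀]; exact inv_mem hx
  | mul x y _ _ hx hy => rw [map_mul]; exact mul_mem hx hy

end Compositum

/-! ### Functoriality of points and characters -/

lemma exists_algHom_comp_eq {k R S T : Type*} [CommSemiring k] [Semiring R] [Algebra k R]
    [Semiring S] [Algebra k S] [Semiring T] [Algebra k T] {f : R →ₐ[k] S}
    (hf : Function.Injective f) {g : T →ₐ[k] S} (h : ∀ x, ∃ y, f y = g x) :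
    ∃ g' : T →ₐ[k] R, f.comp g' = g := by
  let e := AlgEquiv.ofInjective f hf
  exact ⟨e.symm.toAlgHom.comp (g.codRestrict f.range h),
    AlgHom.ext fun x => congrArg Subtype.val (e.apply_symm_apply ⟨g x, h x⟩)⟩

section PointsFunctoriality

variable {F : Type*} [Field F] {A : Type*} [CommRing A] [HopfAlgebra F A]
  {R S : Type*} [CommRing R] [Algebra F R] [CommRing S] [Algebra F S]

lemma Points.ext {s t : Points F A R} (h : ∀ a, s.ofConv a = t.ofConv a) : s = t :=
  WithConv.ofConv_injective (AlgHom.ext h)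

variable [Coalgebra.IsCocomm F A]

@[simp]
lemma Points.map_apply (f : R →ₐ[F] S) (t : Points F A R) (a : A) :
    (Points.map f t).ofConv a = f (t.ofConv a) := rfl

lemma Points.map_injective {f : R →ₐ[F] S} (hf : Function.Injective f) :
    Function.Injective (Points.map (A := A) f) := fun _ _ h =>
  Points.ext fun a => hf (congrArg (fun t : Points F A S => t.ofConv a) h)

lemma Points.exists_map_eq {f : R →ₐ[F] S} (hf : Function.Injective f) {t : Points F A S}
    (ht : ∀ a, ∃ x, f x = t.ofConv a) : ∃ y : Points F A R, Points.map f y = t := by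
  obtain ⟨g, hg⟩ := exists_algHom_comp_eq hf ht
  exact ⟨WithConv.toConv g, WithConv.ofConv_injective hg⟩

end PointsFunctoriality

section CharMap

variable {F : Type*} [Field F] (A : Type*) [CommRing A] [HopfAlgebra F A]
  {K E E' : Type*} [Field K] [Algebra F K] [Field E] [Algebra F E] [Field E'] [Algebra F E']

/-- The extension of scalars `K ⊗ A → E ⊗ A` of the coordinate ring of `T` along `g : K → E`. -/
abbrev coeffMap (g : K →ₐ[F] E) : K ⊗[F] A →ₐ[F] E ⊗[F] A :=
  Algebra.TensorProduct.map g (AlgHom.id F A)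

lemma coeffMap_injective (g : K →ₐ[F] E) : Function.Injective (coeffMap A g) :=
  Module.Flat.rTensor_preserves_injective_linearMap (M := A) g.toLinearMap g.injective

variable {A}

lemma coeffMap_smul (g : K →ₐ[F] E) (k : K) (x : K ⊗[F] A) :
    coeffMap A g (k • x) = g k • coeffMap A g x := by
  simp [Algebra.smul_def]

lemma coeffMap_coeffMap (g : E →ₐ[F] E') (f : K →ₐ[F] E) (x : K ⊗[F] A) :
    coeffMap A g (coeffMap A f x) = coeffMap A (g.comp f) x := by
  rw [← AlgHom.comp_apply, ← Algebra.TensorProduct.map_comp, AlgHom.id_comp]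

lemma counit_coeffMap (g : K →ₐ[F] E) (x : K ⊗[F] A) :
    Coalgebra.counit (R := E) (coeffMap A g x) = g (Coalgebra.counit (R := K) x) := by
  induction x with
  | zero => simp
  | add x y hx hy => simp only [map_add, hx, hy]
  | tmul k a => simp

lemma isGroupLikeElem_coeffMap (g : K →ₐ[F] E) {x : K ⊗[F] A} (hx : IsGroupLikeElem K x) :
    IsGroupLikeElem E (coeffMap A g x) := by
  let gₗ : K ⊗[F] A →ₛₗ[(g : K →+* E)] E ⊗[F] A :=
    { toFun := coeffMap A g, map_add' := map_add _, map_smul' := coeffMap_smul g }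
  have comul_coeffMap (y : K ⊗[F] A) : Coalgebra.comul (R := E) (coeffMap A g y) =
      TensorProduct.map gₗ gₗ (Coalgebra.comul (R := K) y) := by
    induction y with
    | zero => simp
    | add y z hy hz => simp only [map_add, hy, hz]
    | tmul k a => simp [gₗ, ← (Coalgebra.Repr.arbitrary F a).eq, TensorProduct.tmul_sum]
  refine ⟨?_, ?_⟩
  · rw [counit_coeffMap, hx.counit_eq_one, map_one]
  · rw [comul_coeffMap, hx.comul_eq_tmul_self, TensorProduct.map_tmul]
    rfl

/-- The map `X^*(T_K) → X^*(T_E)` given by extension of scalars along `g : K → E`. -/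
def charMap (g : K →ₐ[F] E) : Char F A K →* Char F A E where
  toFun χ := ⟨coeffMap A g χ.val, isGroupLikeElem_coeffMap g χ.2⟩
  map_one' := GroupLike.val_injective (map_one _)
  map_mul' χ ψ := GroupLike.val_injective (map_mul _ χ.val ψ.val)

lemma charMap_charMap (g : E →ₐ[F] E') (f : K →ₐ[F] E) (χ : Char F A K) :
    charMap g (charMap f χ) = charMap (g.comp f) χ :=
  GroupLike.val_injective (coeffMap_coeffMap g f χ.val)

lemma galChar_charMap (g : E ≃ₐ[F] E) (f : K →ₐ[F] E) (χ : Char F A K) :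
    galChar g (charMap f χ) = charMap (g.toAlgHom.comp f) χ :=
  charMap_charMap g.toAlgHom f χ

lemma galChar_galChar_symm (g : E ≃ₐ[F] E) (χ : Char F A E) :
    galChar g (galChar g.symm χ) = χ := by
  have h : g.toAlgHom.comp g.symm.toAlgHom = AlgHom.id F E := g.comp_symm
  refine (galChar_charMap g g.symm.toAlgHom χ).trans (GroupLike.val_injective ?_)
  change coeffMap A (g.toAlgHom.comp g.symm.toAlgHom) χ.val = χ.val
  rw [h, coeffMap, Algebra.TensorProduct.map_id, AlgHom.id_apply]

end CharMap

section SplitTori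

variable {F : Type*} [Field F] {A : Type*} [CommRing A] [HopfAlgebra F A]
  {K E : Type*} [Field K] [Algebra F K] [Field E] [Algebra F E]

lemma IsSplitOver.exists_char_equiv (hK : IsSplitOver F A K) :
    ∃ n : ℕ, Nonempty (Char F A K ≃* Multiplicative (Fin n → ℤ)) := by
  obtain ⟨n, ⟨ψ⟩⟩ := hK
  let c : Multiplicative (Fin n → ℤ) →* Char F A K := MonoidHom.mk'
    (fun v => ⟨ψ.symm (AddMonoidAlgebra.of K (Fin n → ℤ) v),
      (AddMonoidAlgebra.isGroupLikeElem_of (R := K) v.toAdd).map ψ.symm⟩)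
    fun v w => GroupLike.val_injective (by simp only [map_mul, GroupLike.val_mul])
  refine ⟨n, ⟨(MulEquiv.ofBijective c ⟨fun v w h => ?_, fun χ => ?_⟩).symm⟩⟩
  · exact AddMonoidAlgebra.of_injective (ψ.symm.injective (congrArg GroupLike.val h))
  · obtain ⟨v, hv⟩ := AddMonoidAlgebra.isGroupLikeElem_iff_mem_range_of.1 (χ.2.map ψ)
    exact ⟨v, GroupLike.val_injective ((congrArg ψ.symm hv).trans (ψ.symm_apply_apply χ.val))⟩

lemma IsSplitOver.span_range_val (hK : IsSplitOver F A K) :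
    Submodule.span K (Set.range (GroupLike.val (R := K) (A := K ⊗[F] A))) = ⊤ := by
  obtain ⟨n, ⟨ψ⟩⟩ := hK
  have h_le : Submodule.span K {x : AddMonoidAlgebra K (Fin n → ℤ) | IsGroupLikeElem K x} ≤
      (Submodule.span K (Set.range (GroupLike.val (R := K) (A := K ⊗[F] A)))).comap
        (ψ.symm : AddMonoidAlgebra K (Fin n → ℤ) →ₗ[K] K ⊗[F] A) :=
    Submodule.span_le.2 fun x hx => Submodule.subset_span ⟨⟨ψ.symm x, hx.map ψ.symm⟩, rfl⟩
  rw [AddMonoidAlgebra.span_isGroupLikeElem] at h_le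
  exact eq_top_iff.2 fun x _ => ψ.symm_apply_apply x ▸ h_le (x := ψ x) Submodule.mem_top

lemma IsSplitOver.span_range_val_charMap (hK : IsSplitOver F A K) (j : K →ₐ[F] E) :
    Submodule.span E (Set.range fun χ : Char F A K => (charMap j χ).val) = ⊤ := by
  have h_coeffMap (x : K ⊗[F] A) : coeffMap A j x ∈
      Submodule.span E (Set.range fun χ : Char F A K => (charMap j χ).val) := by
    induction hK.span_range_val ▸ Submodule.mem_top (x := x) using Submodule.span_induction with
    | mem x hx =>
      obtain ⟨χ, rfl⟩ := hx
      exact Submodule.subset_span ⟨χ, rfl⟩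
    | zero => exact map_zero (coeffMap A j) ▸ zero_mem _
    | add x y _ _ hx hy => exact map_add (coeffMap A j) x y ▸ add_mem hx hy
    | smul k x _ hx => exact coeffMap_smul j k x ▸ Submodule.smul_mem _ _ hx
  rw [eq_top_iff]
  rintro x -
  induction x with
  | zero => exact zero_mem _
  | add x y hx hy => exact add_mem hx hy
  | tmul e a =>
    have h_tmul : e ⊗ₜ[F] a = e • coeffMap A j (1 ⊗ₜ a) := by simp [TensorProduct.smul_tmul']
    exact h_tmul ▸ Submodule.smul_mem _ _ (h_coeffMap _)

lemma charMap_injective (j : K →ₐ[F] E) : Function.Injective (charMap (A := A) j) := fun _ _ h =>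
  GroupLike.val_injective (coeffMap_injective A j (congrArg GroupLike.val h))

lemma IsSplitOver.charMap_surjective (hK : IsSplitOver F A K) (j : K →ₐ[F] E) :
    Function.Surjective (charMap (A := A) j) := by
  intro χ
  by_contra hχ
  refine (linearIndep_groupLikeVal (R := E)).notMem_span_image (s := Set.range (charMap j)) hχ ?_
  rw [← Set.range_comp]
  exact hK.span_range_val_charMap j ▸ Submodule.mem_top

lemma IsSplitOver.galChar_eq_self (hK : IsSplitOver F A K) (j : K →ₐ[F] E) {φ : E ≃ₐ[F] E}
    (hφ : ∀ x, φ (j x) = j x) (χ : Char F A E) : galChar φ χ = χ := by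
  obtain ⟨χ, rfl⟩ := hK.charMap_surjective j χ
  rw [galChar_charMap, show φ.toAlgHom.comp j = j from AlgHom.ext hφ]

lemma bijective_liftGroupLikeBialgHom {B : Type*} [Ring B] [Bialgebra K B]
    (h : Submodule.span K (Set.range (GroupLike.val (R := K) (A := B))) = ⊤) :
    Function.Bijective (MonoidAlgebra.liftGroupLikeBialgHom (R := K) (A := B)) := by
  have h_eq : ⇑(MonoidAlgebra.liftGroupLikeBialgHom (R := K) (A := B)) =
      Finsupp.linearCombination K GroupLike.val ∘ MonoidAlgebra.coeffEquiv := by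
    ext x
    simp [MonoidAlgebra.lift_apply, Finsupp.linearCombination_apply, MonoidAlgebra.coeffEquiv]
  rw [h_eq]
  refine Function.Bijective.comp ⟨linearIndep_groupLikeVal, ?_⟩ MonoidAlgebra.coeffEquiv.bijective
  rw [← LinearMap.range_eq_top, Finsupp.range_linearCombination, h]

lemma IsSplitOver.of_algHom (hK : IsSplitOver F A K) (j : K →ₐ[F] E) : IsSplitOver F A E := by
  have h_span : Submodule.span E (Set.range (GroupLike.val (R := E) (A := E ⊗[F] A))) = ⊤ :=
    eq_top_iff.2 (hK.span_range_val_charMap j ▸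
      Submodule.span_mono (Set.range_comp_subset_range (charMap j) GroupLike.val))
  obtain ⟨n, ⟨c⟩⟩ := hK.exists_char_equiv
  let cE : Char F A E ≃* Multiplicative (Fin n → ℤ) :=
    (MulEquiv.ofBijective (charMap j) ⟨charMap_injective j, hK.charMap_surjective j⟩).symm.trans c
  exact ⟨n, ⟨(BialgEquiv.ofBijective _ (bijective_liftGroupLikeBialgHom h_span)).symm.trans
    ((MonoidAlgebra.domCongrBialgEquiv E E cE).trans
      (AddMonoidAlgebra.toMultiplicativeBialgEquiv E E (Fin n → ℤ)).symm)⟩⟩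

lemma IsSplitOver.exists_char_lift (hE : IsSplitOver F A E) {U V : Type*}
    [CommGroup U] [CommGroup V] {δ : U →* V} (hδ : Function.Surjective δ) (a : Char F A E →* V) :
    ∃ h : Char F A E →* U, δ.comp h = a := by
  obtain ⟨n, ⟨c⟩⟩ := hE.exists_char_equiv
  let δ' : Additive U →ₗ[ℤ] Additive V := (MonoidHom.toAdditive δ).toIntLinearMap
  let a' : (Fin n → ℤ) →ₗ[ℤ] Additive V :=
    (MonoidHom.toAdditiveRight (a.comp c.symm.toMonoidHom)).toIntLinearMap
  obtain ⟨h, hh⟩ := Module.projective_lifting_property δ' a' hδ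
  refine ⟨(AddMonoidHom.toMultiplicativeLeft h.toAddMonoidHom).comp c.toMonoidHom,
    MonoidHom.ext fun χ => ?_⟩
  exact (DFunLike.congr_fun hh (c χ).toAdd).trans (congrArg a (c.symm_apply_apply χ))

variable [Coalgebra.IsCocomm F A]

lemma evalAlgHom_map (t : Points F A K) (g : K →ₐ[F] E) (x : K ⊗[F] A) :
    evalAlgHom (Points.map g t) (coeffMap A g x) = g (evalAlgHom t x) := by
  induction x with
  | zero => simp only [map_zero]
  | add x y hx hy => simp only [map_add, hx, hy]
  | tmul k a => simp [evalAlgHom]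

lemma evalChar_map_galChar (g : E ≃ₐ[F] E) (t : Points F A E) (χ : Char F A E) :
    evalChar (Points.map g.toAlgHom t) (galChar g χ) = Units.map (g : E →* E) (evalChar t χ) :=
  Units.ext (evalAlgHom_map t g.toAlgHom χ.val)

lemma galCochar_ordPoint (g : E ≃ₐ[F] E) {ord : Eˣ →* Multiplicative ℤ}
    (hord : ∀ x, ord (Units.map (g : E →* E) x) = ord x) (t : Points F A E) :
    galCochar g (ordPoint ord t) = ordPoint ord (Points.map g.toAlgHom t) := by
  ext1 χ
  change ord (evalChar t (galChar g.symm χ)) = ord (evalChar (Points.map g.toAlgHom t) χ)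
  rw [← hord, ← evalChar_map_galChar, galChar_galChar_symm]

lemma ordPoint_eq_one_iff {ord : Eˣ →* Multiplicative ℤ} {t : Points F A E} :
    ordPoint ord t = 1 ↔ ∀ χ, evalChar t χ ∈ ord.ker :=
  MonoidHom.ext_iff

lemma ordPoint_map_eq_one (g : E ≃ₐ[F] E) {ord : Eˣ →* Multiplicative ℤ}
    (hord : ∀ x, ord (Units.map (g : E →* E) x) = ord x) {t : Points F A E}
    (ht : ordPoint ord t = 1) : ordPoint ord (Points.map g.toAlgHom t) = 1 := by
  rw [← galCochar_ordPoint g hord, ht]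
  rfl

lemma IsSplitOver.evalChar_injective (hE : IsSplitOver F A E) :
    Function.Injective (evalChar (F := F) (A := A) (E := E)) := by
  intro s t h
  have h_evalAlgHom : (evalAlgHom s).toLinearMap = (evalAlgHom t).toLinearMap :=
    LinearMap.ext_on_range hE.span_range_val fun χ =>
      congrArg (fun f : Char F A E →* Eˣ => ((f χ : Eˣ) : E)) h
  refine Points.ext fun a => ?_
  simpa [evalAlgHom] using DFunLike.congr_fun h_evalAlgHom (1 ⊗ₜ[F] a)

lemma IsSplitOver.evalChar_surjective (hE : IsSplitOver F A E) :
    Function.Surjective (evalChar (F := F) (A := A) (E := E)) := by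
  intro f
  let e := BialgEquiv.ofBijective _ (bijective_liftGroupLikeBialgHom hE.span_range_val)
  let Ψ : E ⊗[F] A →ₐ[E] E :=
    (MonoidAlgebra.lift E E (Char F A E) ((Units.coeHom E).comp f)).comp e.symm
  let t : Points F A E := WithConv.toConv
    ((Ψ.restrictScalars F).comp Algebra.TensorProduct.includeRight)
  have h_evalAlgHom : evalAlgHom t = Ψ := by
    ext a
    simp [evalAlgHom, t]
  refine ⟨t, MonoidHom.ext fun χ => Units.ext ?_⟩
  have he : e (MonoidAlgebra.single χ 1) = χ.val := by simp [e]
  change evalAlgHom t χ.val = f χ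
  rw [h_evalAlgHom, ← he]
  simp [Ψ]

lemma IsSplitOver.ordPoint_surjective (hE : IsSplitOver F A E)
    {ord : Eˣ →* Multiplicative ℤ} (hord : Function.Surjective ord) :
    Function.Surjective (ordPoint (F := F) (A := A) ord) := by
  intro x
  obtain ⟨h, rfl⟩ := hE.exists_char_lift hord x
  obtain ⟨t, rfl⟩ := hE.evalChar_surjective h
  exact ⟨t, rfl⟩

-- A point of a split torus is a tuple of units, so the equation can be solved unit by unit;
-- that `φ` fixes the characters is what makes `Points.map φ` act on each coordinate separately.
lemma IsSplitOver.exists_map_eq_mul (hE : IsSplitOver F A E) {φ : E ≃ₐ[F] E}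
    (hφ : ∀ χ : Char F A E, galChar φ χ = χ) {U : Subgroup Eˣ}
    (hU : ∀ x ∈ U, Units.map (φ : E →* E) x ∈ U)
    (hsurj : ∀ u ∈ U, ∃ x ∈ U, Units.map (φ : E →* E) x = u * x)
    {t : Points F A E} (ht : ∀ χ, evalChar t χ ∈ U) :
    ∃ s : Points F A E, (∀ χ, evalChar s χ ∈ U) ∧ Points.map φ.toAlgHom s = t * s := by
  let φU : U →* U := ((Units.map (φ : E →* E)).comp U.subtype).codRestrict U fun x => hU x x.2
  have hδ : Function.Surjective (φU / MonoidHom.id U) := by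
    rintro ⟨u, hu⟩
    obtain ⟨x, hx, h⟩ := hsurj u hu
    exact ⟨⟨x, hx⟩, Subtype.ext (div_eq_iff_eq_mul.2 h)⟩
  obtain ⟨h, hh⟩ := hE.exists_char_lift hδ ((evalChar t).codRestrict U ht)
  obtain ⟨s, hs⟩ := hE.evalChar_surjective (U.subtype.comp h)
  have hsχ (χ) : evalChar s χ = (h χ : Eˣ) := DFunLike.congr_fun hs χ
  refine ⟨s, fun χ => hsχ χ ▸ (h χ).2, hE.evalChar_injective (MonoidHom.ext fun χ => ?_)⟩
  have h_div : Units.map (φ : E →* E) (h χ : Eˣ) / (h χ : Eˣ) = evalChar t χ :=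
    congrArg Subtype.val (DFunLike.congr_fun hh χ)
  calc evalChar (Points.map φ.toAlgHom s) χ
      = Units.map (φ : E →* E) (h χ) := by
        rw [← hsχ, ← evalChar_map_galChar, hφ]
    _ = evalChar (t * s) χ := by
        rw [map_mul, MonoidHom.mul_apply, hsχ, ← h_div, div_mul_cancel]

end SplitTori

/-! ### The kernel of the Kottwitz homomorphism -/

section Telescoping

variable {M : Type*} [CommGroup M] (f : M →* M) (x : M) (n : ℕ)

lemma prod_iterate_map_div : ∏ i ∈ Finset.range n, f^[i] (f x / x) = f^[n] x / x := by
  simp_rw [iterate_map_div, ← Function.iterate_succ_apply]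
  exact Finset.prod_range_div (fun i => f^[i] x) n

lemma map_prod_iterate_div_prod_iterate :
    f (∏ i ∈ Finset.range n, f^[i] x) / ∏ i ∈ Finset.range n, f^[i] x = f^[n] x / x := by
  simp_rw [map_prod, ← Function.iterate_succ_apply', ← Finset.prod_div_distrib]
  exact Finset.prod_range_div (fun i => f^[i] x) n

end Telescoping

section Kernel

variable {F : Type*} [Field F] {A : Type*} [CommRing A] [HopfAlgebra F A] [Coalgebra.IsCocomm F A]
  {E : Type*} [Field E] [Algebra F E] {L : Type*} [Field L] [Algebra F L] [Algebra L E]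

lemma Points.map_pow_toAlgHom (τ : E ≃ₐ[F] E) (n : ℕ) (t : Points F A E) :
    Points.map (τ ^ n).toAlgHom t = (Points.map τ.toAlgHom)^[n] t := by
  induction n with
  | zero => rfl
  | succ n ih =>
    rw [Function.iterate_succ_apply', ← ih, pow_succ']
    rfl

lemma Points.map_toAlgHom_map [IsScalarTower F L E] {τE : E ≃ₐ[F] E} {τL : L ≃ₐ[F] L}
    (h : ∀ x, algebraMap L E (τL x) = τE (algebraMap L E x)) (y : Points F A L) :
    Points.map (IsScalarTower.toAlgHom F L E) (Points.map τL.toAlgHom y) =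
      Points.map τE.toAlgHom (Points.map (IsScalarTower.toAlgHom F L E) y) :=
  Points.ext fun _ => h _

/-- Conjugation `g ↦ τ⁻¹ g τ` by an automorphism `τ` of `E` that stabilizes `L`. -/
def conjAut {τE : E ≃ₐ[F] E} {τL : L ≃ₐ[F] L}
    (h : ∀ x, algebraMap L E (τL x) = τE (algebraMap L E x)) (g : E ≃ₐ[L] E) : E ≃ₐ[L] E :=
  AlgEquiv.ofRingEquiv (f := (τE.toRingEquiv.trans g.toRingEquiv).trans τE.symm.toRingEquiv)
    fun x => τE.symm_apply_eq.2 <| by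
      change g (τE (algebraMap L E x)) = _
      rw [← h, g.commutes]

lemma conjAut_apply {τE : E ≃ₐ[F] E} {τL : L ≃ₐ[F] L}
    (h : ∀ x, algebraMap L E (τL x) = τE (algebraMap L E x)) (g : E ≃ₐ[L] E) (x : E) :
    conjAut h g x = τE.symm (g (τE x)) := rfl

variable [IsScalarTower F L E] [FiniteDimensional L E]

lemma normPoint_apply (t : Points F A E) :
    normPoint F A E L t = ∏ g : E ≃ₐ[L] E, Points.map (g.restrictScalars F).toAlgHom t :=
  MonoidHom.finsetProd_apply _ _ _

lemma normPoint_map_galois (g : E ≃ₐ[L] E) (t : Points F A E) :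
    normPoint F A E L (Points.map (g.restrictScalars F).toAlgHom t) = normPoint F A E L t := by
  rw [normPoint_apply, normPoint_apply]
  exact Fintype.prod_equiv (Equiv.mulRight g) _ _ fun _ => rfl

lemma map_normPoint_galois (g : E ≃ₐ[L] E) (t : Points F A E) :
    Points.map (g.restrictScalars F).toAlgHom (normPoint F A E L t) = normPoint F A E L t := by
  rw [normPoint_apply, map_prod]
  exact Fintype.prod_equiv (Equiv.mulLeft g) _ _ fun _ => rfl

lemma normPoint_map_semilinear {τE : E ≃ₐ[F] E} {τL : L ≃ₐ[F] L}
    (h : ∀ x, algebraMap L E (τL x) = τE (algebraMap L E x)) (t : Points F A E) :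
    normPoint F A E L (Points.map τE.toAlgHom t) =
      Points.map τE.toAlgHom (normPoint F A E L t) := by
  have h_symm (x) : algebraMap L E (τL.symm x) = τE.symm (algebraMap L E x) := by
    rw [AlgEquiv.eq_symm_apply, ← h, AlgEquiv.apply_symm_apply]
  rw [normPoint_apply, normPoint_apply, map_prod]
  refine Finset.prod_nbij' (conjAut h) (conjAut h_symm) (fun _ _ => Finset.mem_univ _)
    (fun _ _ => Finset.mem_univ _) (fun g _ => ?_) (fun g _ => ?_)
    fun g _ => Points.ext fun a => ?_
  · ext x
    simp [conjAut_apply]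
  · ext x
    simp [conjAut_apply]
  · simp [conjAut_apply]

lemma exists_map_eq_normPoint [IsGalois L E] (t : Points F A E) :
    ∃ y : Points F A L, Points.map (IsScalarTower.toAlgHom F L E) y = normPoint F A E L t := by
  refine Points.exists_map_eq (algebraMap L E).injective fun a => ?_
  refine (IsGalois.mem_range_algebraMap_iff_fixed _).2 fun g => ?_
  exact congrArg (fun t : Points F A E => t.ofConv a) (map_normPoint_galois g t)

variable {ord : Eˣ →* Multiplicative ℤ}

-- If `x = ordPoint u`, then `g x / x = ordPoint (g u / u)`, and `g u / u` has norm one.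
lemma IsSplitOver.augmentation_le (hE : IsSplitOver F A E) (hord : Function.Surjective ord)
    (hinv : ∀ (g : E ≃ₐ[L] E) (x : Eˣ), ord (Units.map (g : E →* E) x) = ord x) :
    augmentation F A E L ≤ (normPoint F A E L).ker.map (ordPoint ord) := by
  rw [augmentation, Subgroup.closure_le]
  rintro _ ⟨g, x, rfl⟩
  obtain ⟨u, rfl⟩ := hE.ordPoint_surjective hord x
  refine ⟨Points.map (g.restrictScalars F).toAlgHom u / u, ?_, ?_⟩
  · rw [SetLike.mem_coe, MonoidHom.mem_ker, map_div, normPoint_map_galois, div_self']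
  · rw [map_div, galCochar_ordPoint (g.restrictScalars F) (hinv g)]

lemma IsSplitOver.mem_kottwitzGraph_one_iff (hE : IsSplitOver F A E)
    (hord : Function.Surjective ord)
    (hinv : ∀ (g : E ≃ₐ[L] E) (x : Eˣ), ord (Units.map (g : E →* E) x) = ord x)
    {y : Points F A L} : (y, 1) ∈ kottwitzGraph L ord ↔
      ∃ t : Points F A E, normPoint F A E L t = Points.map (IsScalarTower.toAlgHom F L E) y ∧
        ordPoint ord t = 1 := by
  constructor
  · rintro ⟨t, ht⟩
    have hnorm : normPoint F A E L t = Points.map (IsScalarTower.toAlgHom F L E) y :=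
      congrArg Prod.fst ht
    have hclass : (ordPoint ord t : Coinvariants F A E L) = 1 := congrArg Prod.snd ht
    obtain ⟨s, hs, hst⟩ :=
      hE.augmentation_le hord hinv ((QuotientGroup.eq_one_iff _).1 hclass)
    refine ⟨t / s, ?_, ?_⟩
    · rw [map_div, MonoidHom.mem_ker.1 hs, div_one, hnorm]
    · rw [map_div, hst, div_self']
  · rintro ⟨t, hnorm, ht⟩
    have hclass : (ordPoint ord t : Coinvariants F A E L) = 1 := by rw [ht, QuotientGroup.mk_one]
    exact ⟨t, Prod.ext hnorm hclass⟩

variable {τE : E ≃ₐ[F] E} {τL : L ≃ₐ[F] L}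

lemma IsSplitOver.map_mem_kottwitzGraph_one (hE : IsSplitOver F A E)
    (hord : Function.Surjective ord)
    (hinv : ∀ (g : E ≃ₐ[L] E) (x : Eˣ), ord (Units.map (g : E →* E) x) = ord x)
    (h : ∀ x, algebraMap L E (τL x) = τE (algebraMap L E x))
    (hτ : ∀ x, ord (Units.map (τE : E →* E) x) = ord x)
    {y : Points F A L} (hy : (y, 1) ∈ kottwitzGraph L ord) :
    (Points.map τL.toAlgHom y, 1) ∈ kottwitzGraph L ord := by
  obtain ⟨t, hnorm, ht⟩ := (hE.mem_kottwitzGraph_one_iff hord hinv).1 hy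
  refine (hE.mem_kottwitzGraph_one_iff hord hinv).2
    ⟨Points.map τE.toAlgHom t, ?_, ordPoint_map_eq_one τE hτ ht⟩
  rw [normPoint_map_semilinear h, hnorm, Points.map_toAlgHom_map h]

-- The case of a torus on whose characters `τ` acts trivially is applied to a power of `τ`; the
-- telescoping product `s τ(s) ⋯ τ^(m-1)(s)` then turns a solution for `τ^m` into one for `τ`.
lemma IsSplitOver.exists_map_eq_mul_of_pow (hE : IsSplitOver F A E)
    (hτ : ∀ x, ord (Units.map (τE : E →* E) x) = ord x) (m : ℕ)
    (hm : ∀ χ : Char F A E, galChar (τE ^ m) χ = χ)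
    (hsurj : ∀ u ∈ ord.ker, ∃ x ∈ ord.ker,
      Units.map ((τE ^ m : E ≃ₐ[F] E) : E →* E) x = u * x)
    {t : Points F A E} (ht : ordPoint ord t = 1) :
    ∃ s : Points F A E, ordPoint ord s = 1 ∧ Points.map τE.toAlgHom s = t * s := by
  have hτ_pow (i : ℕ) (x : Eˣ) :
      ord (Units.map ((τE ^ i : E ≃ₐ[F] E) : E →* E) x) = ord x := by
    induction i generalizing x with
    | zero => rfl
    | succ i ih => exact pow_succ τE i ▸ (ih (Units.map (τE : E →* E) x)).trans (hτ x)
  obtain ⟨s, hs, hst⟩ := hE.exists_map_eq_mul hm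
    (fun x hx => (hτ_pow m x).trans hx) hsurj (ordPoint_eq_one_iff.1 ht)
  refine ⟨∏ i ∈ Finset.range m, (Points.map τE.toAlgHom)^[i] s, ?_, ?_⟩
  · rw [map_prod]
    refine Finset.prod_eq_one fun i _ => ?_
    rw [← Points.map_pow_toAlgHom]
    exact ordPoint_map_eq_one _ (hτ_pow i) (ordPoint_eq_one_iff.2 hs)
  · rw [← div_eq_iff_eq_mul, map_prod_iterate_div_prod_iterate, ← Points.map_pow_toAlgHom, hst,
      mul_div_cancel_right]

lemma IsSplitOver.exists_map_eq_mul_of_mem_kottwitzGraph_one [IsGalois L E]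
    (hE : IsSplitOver F A E) (hord : Function.Surjective ord)
    (hinv : ∀ (g : E ≃ₐ[L] E) (x : Eˣ), ord (Units.map (g : E →* E) x) = ord x)
    (h : ∀ x, algebraMap L E (τL x) = τE (algebraMap L E x))
    (hsolve : ∀ t : Points F A E, ordPoint ord t = 1 →
      ∃ s : Points F A E, ordPoint ord s = 1 ∧ Points.map τE.toAlgHom s = t * s)
    {y : Points F A L} (hy : (y, 1) ∈ kottwitzGraph L ord) :
    ∃ z : Points F A L, (z, 1) ∈ kottwitzGraph L ord ∧ Points.map τL.toAlgHom z = y * z := by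
  obtain ⟨t, hnorm, ht⟩ := (hE.mem_kottwitzGraph_one_iff hord hinv).1 hy
  obtain ⟨s, hs, hst⟩ := hsolve t ht
  obtain ⟨z, hz⟩ := exists_map_eq_normPoint (L := L) s
  refine ⟨z, (hE.mem_kottwitzGraph_one_iff hord hinv).2 ⟨s, hz.symm, hs⟩,
    Points.map_injective (f := IsScalarTower.toAlgHom F L E) (algebraMap L E).injective ?_⟩
  rw [Points.map_toAlgHom_map h, hz, ← normPoint_map_semilinear h, hst, map_mul, map_mul, hnorm, hz]

end Kernel

section Restriction

variable {F : Type*} [Field F] {C S : Type*} [Field C] [Algebra F C] [Field S] [Algebra F S]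
  {j : S →ₐ[F] C} {τ : C ≃ₐ[F] C}

lemma exists_restrict (h : ∀ x, ∃ y, j y = τ (j x)) (h_symm : ∀ x, ∃ y, j y = τ.symm (j x)) :
    ∃ τS : S ≃ₐ[F] S, ∀ x, j (τS x) = τ (j x) := by
  have hj : Function.Injective j := j.injective
  obtain ⟨f, hf⟩ := exists_algHom_comp_eq hj (g := τ.toAlgHom.comp j) h
  obtain ⟨f', hf'⟩ := exists_algHom_comp_eq hj (g := τ.symm.toAlgHom.comp j) h_symm
  replace hf (x) : j (f x) = τ (j x) := DFunLike.congr_fun hf x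
  replace hf' (x) : j (f' x) = τ.symm (j x) := DFunLike.congr_fun hf' x
  refine ⟨AlgEquiv.ofAlgHom f f' (AlgHom.ext fun x => hj ?_) (AlgHom.ext fun x => hj ?_), hf⟩
  · exact (hf _).trans ((congrArg τ (hf' x)).trans (τ.apply_symm_apply _))
  · exact (hf' _).trans ((congrArg τ.symm (hf x)).trans (τ.symm_apply_apply _))

lemma apply_pow_restrict {τS : S ≃ₐ[F] S} (h : ∀ x, j (τS x) = τ (j x)) (n : ℕ) (x : S) :
    j ((τS ^ n) x) = (τ ^ n) (j x) := by
  rw [AlgEquiv.coe_pow, AlgEquiv.coe_pow]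
  exact Function.Semiconj.iterate_right h n x

end Restriction

section NormalizedOrd

variable {p : ℕ} [Fact p.Prime] {L : Type*} [Field L] [Algebra L ℂ_[p]]
  {E : IntermediateField L ℂ_[p]} {ord : Eˣ →* Multiplicative ℤ}

lemma norm_coe_unit_pos (x : Eˣ) : 0 < ‖((x : E) : ℂ_[p])‖ :=
  norm_pos_iff.2 fun h => x.ne_zero (Subtype.ext h)

lemma norm_coe_unit_div (x y : Eˣ) :
    ‖(((x / y : Eˣ) : E) : ℂ_[p])‖ = ‖((x : E) : ℂ_[p])‖ / ‖((y : E) : ℂ_[p])‖ := by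
  rw [Units.val_div_eq_div_val, IntermediateField.coe_div, norm_div]

namespace IsNormalizedOrd

lemma le_iff (h : IsNormalizedOrd E ord) (x y : Eˣ) :
    (ord y).toAdd ≤ (ord x).toAdd ↔ ‖((x : E) : ℂ_[p])‖ ≤ ‖((y : E) : ℂ_[p])‖ := by
  rw [← sub_nonneg, ← toAdd_div, ← map_div, h.nonneg_iff, norm_coe_unit_div,
    div_le_one (norm_coe_unit_pos y)]

lemma eq_iff (h : IsNormalizedOrd E ord) (x y : Eˣ) :
    ord x = ord y ↔ ‖((x : E) : ℂ_[p])‖ = ‖((y : E) : ℂ_[p])‖ := by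
  rw [← Multiplicative.toAdd.injective.eq_iff, le_antisymm_iff, le_antisymm_iff, h.le_iff, h.le_iff,
    and_comm]

lemma eq_one_iff (h : IsNormalizedOrd E ord) (x : Eˣ) :
    ord x = 1 ↔ ‖((x : E) : ℂ_[p])‖ = 1 := by
  simpa using h.eq_iff x 1

lemma exists_lt_one_forall_norm_le (h : IsNormalizedOrd E ord) :
    ∃ c < 1, ∀ x ∈ E, ‖x‖ < 1 → ‖x‖ ≤ c := by
  obtain ⟨π, hπ⟩ := h.surjective (Multiplicative.ofAdd 1)
  have lt_one_iff (u : Eˣ) : ‖((u : E) : ℂ_[p])‖ < 1 ↔ 1 ≤ (ord u).toAdd := by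
    have hle := h.le_iff 1 u
    rw [map_one, toAdd_one, Units.val_one, IntermediateField.coe_one, norm_one] at hle
    rw [← not_le, ← hle]
    omega
  refine ⟨‖((π : E) : ℂ_[p])‖, (lt_one_iff π).2 (by rw [hπ, toAdd_ofAdd]), fun x hx hlt => ?_⟩
  rcases eq_or_ne x 0 with rfl | hx0
  · simp
  · let u : Eˣ := Units.mk0 ⟨x, hx⟩ fun h0 => hx0 (congrArg Subtype.val h0)
    exact (h.le_iff u π).1 (by rw [hπ, toAdd_ofAdd]; exact (lt_one_iff u).1 hlt)

end IsNormalizedOrd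

end NormalizedOrd

section Kottwitz

variable {p : ℕ} [Fact p.Prime] {F : Type*} [Field F] [Algebra F ℂ_[p]]

/-- The inclusion `K → K L`, along which a splitting of `T` over `K` is extended to `K L`. -/
def toCompositum (K : IntermediateField F ℂ_[p]) : K →ₐ[F] compositum K where
  toFun x := ⟨x, IntermediateField.subset_adjoin _ _ x.2⟩
  map_one' := rfl
  map_mul' _ _ := rfl
  map_zero' := rfl
  map_add' _ _ := rfl
  commutes' _ := rfl

lemma algebraMap_restrict {K : IntermediateField F ℂ_[p]} {τ : ℂ_[p] ≃ₐ[F] ℂ_[p]}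
    {τE : compositum K ≃ₐ[F] compositum K}
    {τL : completedUnramified p F ≃ₐ[F] completedUnramified p F}
    (hτL : ∀ x, (τL x : ℂ_[p]) = τ x) (hτE : ∀ x, (τE x : ℂ_[p]) = τ x)
    (x : completedUnramified p F) :
    algebraMap (completedUnramified p F) (compositum K) (τL x) = τE (algebraMap _ _ x) :=
  Subtype.ext ((hτL x).trans (hτE (algebraMap _ _ x)).symm)

variable {A : Type*} [CommRing A] [HopfAlgebra F A]
  {τ : ℂ_[p] ≃ₐ[F] ℂ_[p]}

namespace SplittingDatum

variable (D : SplittingDatum p F A)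

lemma isSplitOver_compositum : IsSplitOver F A (compositum D.K) :=
  D.split.of_algHom (toCompositum D.K)

lemma kottwitzKer_le [Coalgebra.IsCocomm F A] : D.kottwitzKer ≤ PadicTorus.kottwitzKer p F A :=
  le_iSup (fun D : SplittingDatum p F A => D.kottwitzKer) D

lemma ord_galois (g : compositum D.K ≃ₐ[completedUnramified p F] compositum D.K)
    (x : (compositum D.K)ˣ) :
    D.ord (Units.map (g : compositum D.K →* compositum D.K) x) = D.ord x :=
  have := D.finite
  (D.isNormalizedOrd.eq_iff _ _).2 (norm_galois_compositum D.K g x)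

lemma ord_restrict (hτ : ∀ x, ‖τ x‖ = ‖x‖) {τE : compositum D.K ≃ₐ[F] compositum D.K}
    (hτE : ∀ x, (τE x : ℂ_[p]) = τ x) (x : (compositum D.K)ˣ) :
    D.ord (Units.map (τE : compositum D.K →* compositum D.K) x) = D.ord x :=
  (D.isNormalizedOrd.eq_iff _ _).2 ((congrArg (‖·‖) (hτE x)).trans (hτ _))

end SplittingDatum

variable [Algebra ℚ_[p] F] [FiniteDimensional ℚ_[p] F] [IsScalarTower ℚ_[p] F ℂ_[p]]

lemma exists_restrict_compositum (K : IntermediateField F ℂ_[p]) [Normal F K]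
    (hτ : ∀ x, ‖τ x‖ = ‖x‖) :
    ∃ τE : compositum K ≃ₐ[F] compositum K, ∀ x, (τE x : ℂ_[p]) = τ x := by
  have hτ_symm (x) : ‖τ.symm x‖ = ‖x‖ := by rw [← hτ, AlgEquiv.apply_symm_apply]
  exact exists_restrict (j := (compositum K).val.restrictScalars F)
    (fun x => ⟨⟨τ x, map_mem_compositum K hτ x.2⟩, rfl⟩)
    (fun x => ⟨⟨τ.symm x, map_mem_compositum K hτ_symm x.2⟩, rfl⟩)

lemma exists_restrict_completedUnramified (hτ : ∀ x, ‖τ x‖ = ‖x‖) :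
    ∃ τL : completedUnramified p F ≃ₐ[F] completedUnramified p F,
      ∀ x, (τL x : ℂ_[p]) = τ x := by
  have hτ_symm (x) : ‖τ.symm x‖ = ‖x‖ := by rw [← hτ, AlgEquiv.apply_symm_apply]
  exact exists_restrict (j := (completedUnramified p F).val)
    (fun x => ⟨⟨τ x, map_mem_completedUnramified hτ x.2⟩, rfl⟩)
    (fun x => ⟨⟨τ.symm x, map_mem_completedUnramified hτ_symm x.2⟩, rfl⟩)

namespace SplittingDatum

variable (D : SplittingDatum p F A)

lemma exists_map_eq_mul_of_norm_eq_one {Q : ℕ} (hτ : IsFrobeniusPower τ Q) (hQ : 1 < Q)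
    {τE : compositum D.K ≃ₐ[F] compositum D.K} (hτE : ∀ x, (τE x : ℂ_[p]) = τ x) :
    ∀ u ∈ D.ord.ker, ∃ x ∈ D.ord.ker,
      Units.map (τE : compositum D.K →* compositum D.K) x = u * x := by
  intro u hu
  have := D.finite
  have := D.galois
  obtain ⟨c, hc, hdisc⟩ := D.isNormalizedOrd.exists_lt_one_forall_norm_le
  obtain ⟨x, hxE, hx1, hx⟩ := hτ.exists_apply_eq_mul (S := (compositum D.K).toSubfield)
    (fun x hx => map_mem_compositum D.K hτ.norm_apply hx) (isClosed_compositum D.K) hc hQ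
    (fun ζ hζ => algebraMap_mem_compositum D.K hζ.mem_completedUnramified) hdisc
    (u : compositum D.K).2 ((D.isNormalizedOrd.eq_one_iff u).1 hu)
  have hx0 : x ≠ 0 := norm_ne_zero_iff.1 (hx1.trans_ne one_ne_zero)
  exact ⟨Units.mk0 ⟨x, hxE⟩ fun h0 => hx0 (congrArg Subtype.val h0),
    (D.isNormalizedOrd.eq_one_iff _).2 hx1, Units.ext (Subtype.ext ((hτE ⟨x, hxE⟩).trans hx))⟩

variable [Coalgebra.IsCocomm F A]
  {τL : completedUnramified p F ≃ₐ[F] completedUnramified p F} (hτL : ∀ x, (τL x : ℂ_[p]) = τ x)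
  {y : Points F A (completedUnramified p F)}

include hτL

lemma map_mem_kottwitzKer (hτ : ∀ x, ‖τ x‖ = ‖x‖) (hy : y ∈ D.kottwitzKer) :
    Points.map τL.toAlgHom y ∈ D.kottwitzKer := by
  have := D.finite
  have := D.galois
  obtain ⟨τE, hτE⟩ := exists_restrict_compositum D.K hτ
  exact D.isSplitOver_compositum.map_mem_kottwitzGraph_one D.isNormalizedOrd.surjective
    D.ord_galois (algebraMap_restrict hτL hτE) (D.ord_restrict hτ hτE) hy

lemma exists_map_eq_mul {Q : ℕ} (hτ : IsFrobeniusPower τ Q) (hQ : 1 < Q)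
    (hy : y ∈ D.kottwitzKer) : ∃ z ∈ D.kottwitzKer, Points.map τL.toAlgHom z = y * z := by
  have := D.finite
  have := D.galois
  obtain ⟨τE, hτE⟩ := exists_restrict_compositum D.K hτ.norm_apply
  obtain ⟨m, hm0, hm⟩ := exists_pow_apply_eq_self D.K τ
  have hτE_pow (x) : ((τE ^ m) x : ℂ_[p]) = (τ ^ m) x :=
    apply_pow_restrict (j := (compositum D.K).val.restrictScalars F) hτE m x
  have hχ (χ : Char F A (compositum D.K)) : galChar (τE ^ m) χ = χ :=
    D.split.galChar_eq_self (toCompositum D.K)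
      (fun x => Subtype.ext ((hτE_pow _).trans (hm x x.2))) χ
  refine D.isSplitOver_compositum.exists_map_eq_mul_of_mem_kottwitzGraph_one
    D.isNormalizedOrd.surjective D.ord_galois
    (algebraMap_restrict hτL hτE) (fun t ht => ?_) hy
  exact D.isSplitOver_compositum.exists_map_eq_mul_of_pow (D.ord_restrict hτ.norm_apply hτE) m hχ
    (D.exists_map_eq_mul_of_norm_eq_one (hτ.pow m) (Nat.one_lt_pow hm0 hQ) hτE_pow) ht

end SplittingDatum

variable [Coalgebra.IsCocomm F A]
  {τL : completedUnramified p F ≃ₐ[F] completedUnramified p F} (hτL : ∀ x, (τL x : ℂ_[p]) = τ x)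
  {y : Points F A (completedUnramified p F)}

include hτL

lemma map_mem_kottwitzKer (hτ : ∀ x, ‖τ x‖ = ‖x‖) (hy : y ∈ kottwitzKer p F A) :
    Points.map τL.toAlgHom y ∈ kottwitzKer p F A := by
  have hle : kottwitzKer p F A ≤ (kottwitzKer p F A).comap (Points.map τL.toAlgHom) :=
    iSup_le fun D _ hz => D.kottwitzKer_le (D.map_mem_kottwitzKer hτL hτ hz)
  exact hle hy

lemma exists_map_eq_mul_of_mem_kottwitzKer {Q : ℕ} (hτ : IsFrobeniusPower τ Q) (hQ : 1 < Q)
    (hy : y ∈ kottwitzKer p F A) :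
    ∃ z ∈ kottwitzKer p F A, Points.map τL.toAlgHom z = y * z := by
  have hle : kottwitzKer p F A ≤
      (kottwitzKer p F A).map (Points.map τL.toAlgHom / MonoidHom.id _) := by
    refine iSup_le fun D w hw => ?_
    obtain ⟨z, hz, h⟩ := D.exists_map_eq_mul hτL hτ hQ hw
    exact ⟨z, D.kottwitzKer_le hz, div_eq_iff_eq_mul.2 h⟩
  obtain ⟨z, hz, h⟩ := hle hy
  exact ⟨z, hz, div_eq_iff_eq_mul.1 h⟩

end Kottwitz

section Norm

lemma prod_range_pow_eq_prod_univ {G M : Type*} [Group G] [Fintype G] [CommMonoid M] {g : G}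
    (hg : ∀ x, x ∈ Subgroup.zpowers g) (f : G → M) :
    ∏ i ∈ Finset.range (Nat.card G), f (g ^ i) = ∏ x, f x := by
  classical
  rw [← IsCyclic.image_range_card hg, Finset.prod_image]
  rw [← orderOf_eq_card_of_forall_mem_zpowers hg]
  exact fun i hi j hj h => pow_injOn_Iio_orderOf (by simpa using hi) (by simpa using hj) h

lemma exists_surjective_of_map_eq_map {G G' M : Type*} [Group G] [Group G'] [Group M]
    {H : Subgroup G} {H' : Subgroup G'} {f : G →* M} {g : G' →* M} (hg : Function.Injective g)
    (h : H.map f = H'.map g) :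
    ∃ N : H →* H', (∀ x, g (N x) = f x) ∧ Function.Surjective N := by
  let e : H' ≃* H'.map g := H'.equivMapOfInjective g hg
  have hf (x : H) : f x ∈ H'.map g := h ▸ Subgroup.mem_map_of_mem f x.2
  let N : H →* H' := e.symm.toMonoidHom.comp ((f.comp H.subtype).codRestrict _ hf)
  have hN (x : H) : g (N x) = f x := congrArg Subtype.val (e.apply_symm_apply ⟨f x, hf x⟩)
  refine ⟨N, hN, fun y => ?_⟩
  obtain ⟨x, hx, hxy⟩ : g y ∈ H.map f := h ▸ Subgroup.mem_map_of_mem g y.2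
  exact ⟨⟨x, hx⟩, Subtype.ext (hg ((hN _).trans hxy))⟩

variable {F : Type*} [Field F] {A : Type*} [CommRing A] [HopfAlgebra F A] [Coalgebra.IsCocomm F A]

lemma prod_range_map_pow_eq_normPoint {K : Type*} [Field K] [Algebra F K] [FiniteDimensional F K]
    [IsGalois F K] {θ : K ≃ₐ[F] K} (hθ : ∀ g, g ∈ Subgroup.zpowers θ) (t : Points F A K) :
    ∏ i ∈ Finset.range (Module.finrank F K), Points.map (θ ^ i).toAlgHom t =
      normPoint F A K F t := by
  rw [normPoint_apply, ← IsGalois.card_aut_eq_finrank]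
  exact prod_range_pow_eq_prod_univ hθ fun g => Points.map g.toAlgHom t

variable {p : ℕ} [Fact p.Prime] [Algebra ℚ_[p] F] [FiniteDimensional ℚ_[p] F] [Algebra F ℂ_[p]]
  [IsScalarTower ℚ_[p] F ℂ_[p]] {M : IntermediateField F ℂ_[p]} [FiniteDimensional F M]
  (hM : IsUnramified M)

/-- The inclusion `M → L` of a finite unramified extension of `F`, along which `T(M)_1` is
defined. -/
abbrev IsUnramified.inclusion : M →ₐ[F] completedUnramified p F :=
  IntermediateField.inclusion (le_completedUnramified M hM)

section Frobenius

variable {σ : ℂ_[p] ≃ₐ[F] ℂ_[p]} (hσ : IsFrobeniusPower σ (baseCard p F))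
  {σL : completedUnramified p F ≃ₐ[F] completedUnramified p F} (hσL : ∀ x, (σL x : ℂ_[p]) = σ x)

include hσ hσL

lemma map_inclusion_normPoint (t : Points F A M) :
    Points.map hM.inclusion (normPoint F A M F t) =
      ∏ i ∈ Finset.range (Module.finrank F M),
        (Points.map σL.toAlgHom)^[i] (Points.map hM.inclusion t) := by
  have := hM.isGalois
  have hgen (g : M ≃ₐ[F] M) : g ∈ Subgroup.zpowers (σ.restrictNormal M) :=
    hM.zpowers_restrictNormal_eq_top hσ ▸ Subgroup.mem_top g
  rw [← prod_range_map_pow_eq_normPoint hgen, map_prod]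
  refine Finset.prod_congr rfl fun i _ => ?_
  rw [← Points.map_pow_toAlgHom]
  refine Points.ext fun a => Subtype.ext ?_
  have hleft := apply_pow_restrict (j := M.val)
    (fun x => AlgEquiv.restrictNormal_commutes σ M x) i (t.ofConv a)
  have hright := apply_pow_restrict (j := (completedUnramified p F).val) hσL i
    (hM.inclusion (t.ofConv a))
  exact hleft.trans hright.symm

lemma normPoint_mem_map_pointsOne {t : Points F A M}
    (ht : t ∈ pointsOne A hM.inclusion) :
    normPoint F A M F t ∈ (pointsOne A (Algebra.ofId F (completedUnramified p F))).map
      (Points.map (Algebra.ofId F M)) := by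
  have := hM.isGalois
  obtain ⟨y, hy⟩ := exists_map_eq_normPoint (L := F) t
  refine ⟨y, ?_, hy⟩
  have hiterate (i : ℕ) : (Points.map σL.toAlgHom)^[i] (Points.map hM.inclusion t) ∈
      kottwitzKer p F A := by
    induction i with
    | zero => exact ht
    | succ i ih =>
      rw [Function.iterate_succ_apply']
      exact map_mem_kottwitzKer hσL hσ.norm_apply ih
  have hmem : Points.map hM.inclusion (Points.map (IsScalarTower.toAlgHom F F M) y) ∈
      kottwitzKer p F A := by
    rw [hy, map_inclusion_normPoint hM hσ hσL]
    exact prod_mem fun i _ => hiterate i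
  exact hmem

lemma exists_map_inclusion_eq {r : ℕ} {x : Points F A (completedUnramified p F)}
    (hcard : resCard M = baseCard p F ^ r) (hx : (Points.map σL.toAlgHom)^[r] x = x) :
    ∃ t : Points F A M, Points.map hM.inclusion t = x := by
  refine Points.exists_map_eq hM.inclusion.injective fun a => ?_
  have hfix : (σ ^ r) (x.ofConv a : ℂ_[p]) = x.ofConv a := by
    rw [← Points.map_pow_toAlgHom] at hx
    exact (apply_pow_restrict (j := (completedUnramified p F).val) hσL r (x.ofConv a)).symm.trans
      (congrArg (fun x : Points F A (completedUnramified p F) => (x.ofConv a).1) hx)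
  exact ⟨⟨_, hM.mem_of_apply_eq_self (hcard ▸ hσ.pow r) (x.ofConv a).2 hfix⟩, rfl⟩

-- If `y = σ^r z / z`, then `σ z / z` is a point of `T(M)`, and its norm telescopes to `y`.
lemma exists_mem_pointsOne_normPoint_eq {y : Points F A F}
    (hy : y ∈ pointsOne A (Algebra.ofId F (completedUnramified p F))) :
    ∃ t ∈ pointsOne A hM.inclusion,
      normPoint F A M F t = Points.map (Algebra.ofId F M) y := by
  have := hM.isGalois
  set r := Module.finrank F M
  set f := Points.map (A := A) σL.toAlgHom with hf
  set y₀ := Points.map (Algebra.ofId F (completedUnramified p F)) y with hy₀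
  have hy₀_fixed : f y₀ = y₀ := Points.ext fun a => σL.commutes _
  have hcard : resCard M = baseCard p F ^ r := hM.resCard_eq_pow_finrank hσ
  obtain ⟨z, hz, hzy⟩ := exists_map_eq_mul_of_mem_kottwitzKer
    (apply_pow_restrict (j := (completedUnramified p F).val) hσL r) (hσ.pow r)
    (Nat.one_lt_pow Module.finrank_pos.ne' one_lt_baseCard) hy
  rw [Points.map_pow_toAlgHom, ← hf, ← hy₀] at hzy
  have hfixed : f^[r] (f z / z) = f z / z := by
    rw [iterate_map_div, ← Function.iterate_succ_apply, Function.iterate_succ_apply', hzy, map_mul,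
      hy₀_fixed, mul_div_mul_left_eq_div]
  obtain ⟨t, ht⟩ := exists_map_inclusion_eq hM hσ hσL hcard hfixed
  refine ⟨t, ?_, Points.map_injective hM.inclusion.injective ?_⟩
  · change Points.map _ t ∈ kottwitzKer p F A
    rw [ht]
    exact div_mem (map_mem_kottwitzKer hσL hσ.norm_apply hz) hz
  · rw [map_inclusion_normPoint hM hσ hσL, ht, prod_iterate_map_div, hzy, mul_div_cancel_right]
    rfl

end Frobenius

lemma map_normPoint_pointsOne :
    (pointsOne A hM.inclusion).map (normPoint F A M F) =
      (pointsOne A (Algebra.ofId F (completedUnramified p F))).map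
        (Points.map (Algebra.ofId F M)) := by
  obtain ⟨σ, hσ_norm, hσ_root⟩ := exists_frobenius p F
  have hσ : IsFrobeniusPower σ (baseCard p F) := ⟨hσ_norm, hσ_root⟩
  obtain ⟨σL, hσL⟩ := exists_restrict_completedUnramified hσ_norm
  apply le_antisymm
  · rintro _ ⟨t, ht, rfl⟩
    exact normPoint_mem_map_pointsOne hM hσ hσL ht
  · rintro _ ⟨y, hy, rfl⟩
    exact exists_mem_pointsOne_normPoint_eq hM hσ hσL hy

end Norm

end PadicTorus

end

open PadicTorus in
/-- `F` is a `p`-adic field embedded in `ℂ_p`, `T = Spec A` an `F`-torus, `F_r` the unramified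
extension of `F` of degree `r`, and `θ` a generator of `Gal(F_r/F)`. The norm
`t ↦ t θ(t) ⋯ θ^(r-1)(t)` is a surjective homomorphism `T(F_r)_1 → T(F)_1`. -/
theorem lemma8 (p : ℕ) [Fact p.Prime] (F : Type*) [Field F] [Algebra ℚ_[p] F]
    [FiniteDimensional ℚ_[p] F] [Algebra F ℂ_[p]] [IsScalarTower ℚ_[p] F ℂ_[p]]
    (A : Type*) [CommRing A] [HopfAlgebra F A] [Coalgebra.IsCocomm F A]
    (hT : PadicTorus.IsTorus F A)
    (r : ℕ) (Fr : IntermediateField F ℂ_[p]) [FiniteDimensional F Fr]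
    (hFr : PadicTorus.IsUnramified Fr) (hr : Module.finrank F Fr = r)
    (θ : Fr ≃ₐ[F] Fr) (hθ : ∀ g : Fr ≃ₐ[F] Fr, g ∈ Subgroup.zpowers θ) :
    ∃ N : PadicTorus.pointsOne A
          (IntermediateField.inclusion (PadicTorus.le_completedUnramified Fr hFr)) →*
        PadicTorus.pointsOne A (Algebra.ofId F (PadicTorus.completedUnramified p F)),
      (∀ t, PadicTorus.Points.map (Algebra.ofId F Fr) (N t : PadicTorus.Points F A F) =
        ∏ i ∈ Finset.range r,
          PadicTorus.Points.map (θ ^ i).toAlgHom (t : PadicTorus.Points F A Fr)) ∧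
      Function.Surjective N := by
  have := hFr.isGalois
  obtain ⟨N, hN, hsurj⟩ := exists_surjective_of_map_eq_map
    (Points.map_injective (A := A) (f := Algebra.ofId F Fr) (algebraMap F Fr).injective)
    (map_normPoint_pointsOne hFr)
  refine ⟨N, fun t => ?_, hsurj⟩
  rw [hN, ← hr, prod_range_map_pow_eq_normPoint hθ]
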